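/- Theorem 1. A fooling-set pattern of size $n$ is a matrix $R\in\{0,1\}^{n\times n}$ with $R_{k,k}=1$ for all $k$ and $R_{k,\ell}R_{\ell,k}=0$ for all $k\ne\ell$. It has density $p\in(0,1]$ if it has exactly $\lceil p\binom n2\rceil$ off-diagonal $1$-entries. Let $Q(n)$ be a fooling-set pattern drawn uniformly at random from all fooling-set patterns of size $n$, and $R(n,p)$ one drawn uniformly at random from all those with density $p$. For a field $\mathbb F$ and $R\in\{0,1\}^{n\times n}$ let $\operatorname{mr}_{\mathbb F}(R)$ be the minimum rank of a matrix $M\in\mathbb F^{n\times n}$ with $M_{k,\ell}\ne0\iff R_{k,\ell}=1$ for all $k,\ell$. "A.a.s." means with probability tending to $1$ as $n\to\infty$. (a) For every constant $C$ there is a $c>0$ such that for every field $\mathbb F$ and every $p=p(n)\in(0,1]$ with $p(n)\le C/n$ for all large $n$, a.a.s. $\operatorname{mr}_{\mathbb F}(R(n,p))\ge c\,n$. (b) There is an absolute constant $c>0$ such that, for all finite fields $\mathbb F=\mathbb F_n$ (which may vary with $n$), of size $F=F(n)=|\mathbb F_n|$, and all $p=p(n)$ with $100\max(1,\ln\ln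 F)/n\le p\le1$ for all large $n$, a.a.s. $$\operatorname{mr}_{\mathbb F}(R(n,p))\ \ge\ c\,\frac{\log(1/p)}{\log(1/p)+\log F}\,n \qquad\text{and}\qquad \operatorname{mr}_{\mathbb F}(R(n,p))\ \ge\ c\,\frac{n}{\log F}.$$ (c) For every constant $p\in(0,1]$ there is a $c>0$ such that for every field $\mathbb F$, a.a.s. $\operatorname{mr}_{\mathbb F}(R(n,p))\ge c\,n$. Likewise there is a $c>0$ such that for every field $\mathbb F$, a.a.s. $\operatorname{mr}_{\mathbb F}(Q(n))\ge c\,n$. -/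

import Mathlib

universe u

open Filter Topology

/-- Square matrices of size `n` with entries in `{0,1}`; `false` stands for `0`, `true` for `1`. -/
abbrev BinMatrix (n : ℕ) : Type := Fin n → Fin n → Bool

/-- A fooling-set pattern: ones on the diagonal, and `R k l * R l k = 0` whenever `k ≠ l`. -/
def IsFoolingPattern {n : ℕ} (R : BinMatrix n) : Prop :=
  (∀ k, R k k = true) ∧ ∀ k l, k ≠ l → (R k l && R l k) = false

/-- The number of off-diagonal one-entries. -/
def offDiagOnes {n : ℕ} (R : BinMatrix n) : ℕ :=
  (Finset.univ.filter fun e : Fin n × Fin n => e.1 ≠ e.2 ∧ R e.1 e.2 = true).card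

/-- `R` has density `p` if it has exactly `⌈p * (n choose 2)⌉` off-diagonal one-entries. -/
def HasDensity {n : ℕ} (R : BinMatrix n) (p : ℝ) : Prop :=
  offDiagOnes R = ⌈p * (n.choose 2 : ℝ)⌉₊

open Classical in
/-- The zero-nonzero pattern `σ(M)` of a square matrix over a field. -/
noncomputable def zeroNonzeroPattern {K : Type u} [Field K] {n : ℕ}
    (M : Matrix (Fin n) (Fin n) K) : BinMatrix n :=
  fun k l => decide (M k l ≠ 0)

/-- The minimum rank of a matrix over `K` with zero-nonzero pattern `R`. -/
noncomputable def minRank (K : Type u) [Field K] {n : ℕ} (R : BinMatrix n) : ℕ :=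
  sInf {r : ℕ | ∃ M : Matrix (Fin n) (Fin n) K, zeroNonzeroPattern M = R ∧ M.rank = r}

/-- The set over which the minimum is taken is nonempty, so the minimum is attained. -/
theorem exists_rank_eq_minRank (K : Type u) [Field K] {n : ℕ} (R : BinMatrix n) :
    ∃ M : Matrix (Fin n) (Fin n) K, zeroNonzeroPattern M = R ∧ M.rank = minRank K R := by
  apply Nat.sInf_mem
    (s := {r : ℕ | ∃ M : Matrix (Fin n) (Fin n) K, zeroNonzeroPattern M = R ∧ M.rank = r})
  refine ⟨_, Matrix.of fun k l => if R k l = true then 1 else 0, ?_, rfl⟩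
  funext k l
  cases h : R k l <;> simp [zeroNonzeroPattern, h]

/-- The law of `Q(n)`: uniform on all fooling-set patterns of size `n`. -/
noncomputable def lawQ (n : ℕ) : MeasureTheory.Measure (BinMatrix n) :=
  ProbabilityTheory.uniformOn {R | IsFoolingPattern R}

/-- The law of `R(n,p)`: uniform on all fooling-set patterns of size `n` with density `p`. -/
noncomputable def lawR (n : ℕ) (p : ℝ) : MeasureTheory.Measure (BinMatrix n) :=
  ProbabilityTheory.uniformOn {R | IsFoolingPattern R ∧ HasDensity R p}

/-! Three mechanisms force large rank.

When there are O(n) off-diagonal ones, the graph joining k and l when R has a one at (k,l) or (l,k)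
has bounded average degree. Its low-degree vertices contain an independent set of linear size, on
which any matrix with pattern R is diagonal and nonsingular (`le_minRank_mul_add`). This holds for
every pattern, not just almost every one.

At constant density, counting suffices over any field. A matrix of rank at most k is a product of
n×k and k×n factors, so its pattern is the zero pattern of n² quadratic polynomials in 2nk
variables. Such patterns number at most the dimension of the polynomials of degree at most 2n²
(`card_zeroPatterns_le`), which for k = cn with c small is far below the 2^m orientations of m ones.

In between, over a finite field, the few indices of high degree are set aside. Either half of the
ones touch them, or half survive in a matrix of rank at most k with sparse rows and columns. Such a
matrix is determined by k of its rows and k of its columns, so there are few. In both cases R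
contains one of few sets of about m/2 positions, each contained with probability at most (m /
2N)^(m/2), where N = n(n-1)/2; a union bound finishes (`card_minRank_le_mul_pow_le`). -/

/-! ### Linear algebra of low-rank matrices -/

/-- The columns of a matrix of rank at most `k` are spanned by `k` of them. -/
theorem exists_eq_submatrix_mul_of_rank_le {K : Type*} [Field K] {m n k : ℕ} [NeZero n]
    (M : Matrix (Fin m) (Fin n) K) (h : M.rank ≤ k) :
    ∃ (J : Fin k → Fin n) (X : Matrix (Fin k) (Fin n) K), M = M.submatrix id J * X := by
  rw [Matrix.rank_eq_finrank_span_cols] at h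
  obtain ⟨f, hf, hspan, -⟩ := Submodule.exists_fun_fin_finrank_span_eq K (Set.range M.col)
  choose g hg using hf
  -- If the rank is below `k`, the surplus slots repeat column 0.
  let J : Fin k → Fin n := fun i =>
    if hi : i.1 < Module.finrank K (Submodule.span K (Set.range M.col)) then g ⟨i.1, hi⟩ else 0
  have hcol : ∀ l, ∃ x : Fin k → K, ∑ i, x i • M.col (J i) = M.col l := by
    intro l
    rw [← Submodule.mem_span_range_iff_exists_fun]
    have hl : M.col l ∈ Submodule.span K (Set.range f) := by
      rw [hspan]; exact Submodule.subset_span ⟨l, rfl⟩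
    refine Submodule.span_mono ?_ hl
    rintro _ ⟨i, rfl⟩
    refine ⟨⟨i.1, i.2.trans_le h⟩, ?_⟩
    simp only [J, i.2, dif_pos]
    exact hg i
  choose x hx using hcol
  refine ⟨J, Matrix.of fun i l => x l i, ?_⟩
  ext a l
  have := congrFun (hx l) a
  simp only [Finset.sum_apply, Pi.smul_apply, Matrix.col_apply, smul_eq_mul] at this
  rw [← this, Matrix.mul_apply]
  exact Finset.sum_congr rfl fun i _ => by simp [mul_comm]

/-- A matrix is determined by rows and columns that span its row and column spaces. -/
theorem eq_of_submatrix_eq {K : Type*} [Field K] {n k : ℕ} {I J : Fin k → Fin n}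
    {M M' : Matrix (Fin n) (Fin n) K} {X X' : Matrix (Fin k) (Fin n) K}
    {Y : Matrix (Fin n) (Fin k) K}
    (hM : M = M.submatrix id J * X) (hM' : M' = M'.submatrix id J * X')
    (hY : M = Y * M.submatrix I id)
    (hc : M.submatrix id J = M'.submatrix id J) (hr : M.submatrix I id = M'.submatrix I id) :
    M = M' := by
  rw [← hc] at hM'
  have hYJ : M.submatrix id J = Y * M.submatrix I J := by
    conv_lhs => rw [hY]
    ext a b
    simp [Matrix.mul_apply]
  -- `X` and `X'` both turn the common block on `I × J` into the common rows `I`, so both matrices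
  -- equal `Y` times those rows.
  have h1 : M.submatrix I J * X = M.submatrix I id := by
    conv_rhs => rw [hM]
    ext a b
    simp [Matrix.mul_apply]
  have h2 : M.submatrix I J * X' = M.submatrix I id := by
    conv_rhs => rw [hr, hM']
    ext a b
    simp [Matrix.mul_apply]
  rw [hM, hM', hYJ, Matrix.mul_assoc, Matrix.mul_assoc, h1, h2]

theorem exists_eq_mul_submatrix_of_rank_le {K : Type*} [Field K] {n k : ℕ} [NeZero n]
    (M : Matrix (Fin n) (Fin n) K) (h : M.rank ≤ k) :
    ∃ (I : Fin k → Fin n) (Y : Matrix (Fin n) (Fin k) K), M = Y * M.submatrix I id := by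
  obtain ⟨I, X, hX⟩ := exists_eq_submatrix_mul_of_rank_le M.transpose
    ((Matrix.rank_transpose M).trans_le h)
  refine ⟨I, X.transpose, ?_⟩
  have := congrArg Matrix.transpose hX
  rwa [Matrix.transpose_transpose, Matrix.transpose_mul] at this

/-- A principal submatrix that is diagonal with nonzero diagonal bounds the rank from below. -/
theorem card_le_rank_of_diagonal {K : Type*} [Field K] {n : ℕ} (M : Matrix (Fin n) (Fin n) K)
    (I : Finset (Fin n)) (hd : ∀ i ∈ I, M i i ≠ 0)
    (ho : ∀ i ∈ I, ∀ j ∈ I, i ≠ j → M i j = 0) : I.card ≤ M.rank := by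
  have hD : M.submatrix (fun i : I => i.1) (fun i : I => i.1) =
      Matrix.diagonal fun i : I => M i.1 i.1 := by
    ext i j
    by_cases hij : i = j
    · subst hij; simp
    · rw [Matrix.diagonal_apply_ne _ hij]
      exact ho _ i.2 _ j.2 fun h => hij (Subtype.ext h)
  have hr := Matrix.rank_submatrix_le M (fun i : I => i.1) (fun i : I => i.1)
  rw [hD, Matrix.rank_of_isUnit] at hr
  · simpa using hr
  · rw [Matrix.isUnit_diagonal, Pi.isUnit_iff]
    exact fun i => (hd _ i.2).isUnit

/-! ### Zero patterns of polynomial systems -/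

/-- Counting functions with a bounded sum by weights. -/
theorem card_filter_sum_le {ι : Type*} [Fintype ι] [DecidableEq ι] (D : ℕ) {δ : ℝ}
    (h0 : 0 < δ) (h1 : δ ≤ 1 / 2) :
    (((Fintype.piFinset fun _ : ι => Finset.range (D + 1)).filter
      fun f => ∑ i, f i ≤ D).card : ℝ) ≤
      Real.exp (2 * δ * D) * (1 / δ) ^ Fintype.card ι := by
  have hy : 0 < 1 - δ := by linarith
  have key : (((Fintype.piFinset fun _ : ι => Finset.range (D + 1)).filter
      fun f => ∑ i, f i ≤ D).card : ℝ) * (1 - δ) ^ D ≤ (1 / δ) ^ Fintype.card ι := by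
    calc _ = ∑ f ∈ (Fintype.piFinset fun _ : ι => Finset.range (D + 1)).filter
          fun f => ∑ i, f i ≤ D, (1 - δ) ^ D := by simp
      _ ≤ ∑ f ∈ (Fintype.piFinset fun _ : ι => Finset.range (D + 1)).filter
          fun f => ∑ i, f i ≤ D, ∏ i, (1 - δ) ^ f i := by
        refine Finset.sum_le_sum fun f hf => ?_
        rw [Finset.prod_pow_eq_pow_sum]
        exact pow_le_pow_of_le_one hy.le (by linarith) (Finset.mem_filter.1 hf).2
      _ ≤ ∑ f ∈ Fintype.piFinset fun _ : ι => Finset.range (D + 1), ∏ i, (1 - δ) ^ f i :=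
        Finset.sum_le_sum_of_subset_of_nonneg (Finset.filter_subset _ _)
          fun f _ _ => Finset.prod_nonneg fun i _ => by positivity
      _ = (∑ j ∈ Finset.range (D + 1), (1 - δ) ^ j) ^ Fintype.card ι := by
        rw [Finset.sum_prod_piFinset]
        simp
      _ ≤ _ := by
        refine pow_le_pow_left₀ (Finset.sum_nonneg fun i _ => by positivity) ?_ _
        rw [geom_sum_eq (by linarith), le_div_iff₀ h0, div_mul_eq_mul_div, div_le_iff_of_neg
          (by linarith)]
        nlinarith [pow_pos hy (D + 1)]
  -- For δ ≤ 1/2, (1 - δ)(1 + 2δ) ≥ 1.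
  have hexp : Real.exp (-(2 * δ * D)) ≤ (1 - δ) ^ D := by
    have : Real.exp (-(2 * δ)) ≤ 1 - δ := by
      have h3 := Real.add_one_le_exp (2 * δ)
      rw [Real.exp_neg, inv_le_comm₀ (Real.exp_pos _) hy]
      refine le_trans ?_ h3
      rw [inv_le_iff_one_le_mul₀ hy]
      nlinarith
    calc _ = Real.exp (-(2 * δ)) ^ D := by rw [← Real.exp_nat_mul]; ring_nf
      _ ≤ _ := pow_le_pow_left₀ (Real.exp_pos _).le this _
  have h4 := mul_le_mul_of_nonneg_left hexp (Nat.cast_nonneg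
    (((Fintype.piFinset fun _ : ι => Finset.range (D + 1)).filter
      fun f => ∑ i, f i ≤ D).card) : (0:ℝ) ≤ _)
  have h5 := h4.trans key
  rw [Real.exp_neg, ← div_eq_mul_inv, div_le_iff₀ (Real.exp_pos _)] at h5
  linarith

/-- Monomials form a basis, so the dimension counts exponent vectors. The free parameter δ balances
the cost of the degree against that of the number of variables, replacing a binomial coefficient. -/
theorem finrank_restrictTotalDegree_le (K σ : Type*) [Field K] [Fintype σ] (D : ℕ) {δ : ℝ}
    (h0 : 0 < δ) (h1 : δ ≤ 1 / 2) :
    (Module.finrank K (MvPolynomial.restrictTotalDegree σ K D) : ℝ) ≤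
      Real.exp (2 * δ * D) * (1 / δ) ^ Fintype.card σ := by
  classical
  refine le_trans ?_ (card_filter_sum_le (ι := σ) D h0 h1)
  rw [Nat.cast_le]
  have hb := Module.finrank_eq_nat_card_basis
    (MvPolynomial.basisRestrictSupport K {s : σ →₀ ℕ | (s.sum fun _ e => e) ≤ D})
  change Module.finrank K (MvPolynomial.restrictTotalDegree σ K D) = _ at hb
  rw [hb, ← Nat.card_eq_finsetCard]
  have hmem : ∀ s : {s : σ →₀ ℕ | (s.sum fun _ e => e) ≤ D}, (⇑s.1 : σ → ℕ) ∈
      ((Fintype.piFinset fun _ : σ => Finset.range (D + 1)).filter fun f => ∑ i, f i ≤ D) := by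
    rintro ⟨s, hs⟩
    have hs' : ∑ i, s i ≤ D := by
      rw [Set.mem_ofPred_eq, Finsupp.sum_fintype _ _ fun _ => rfl] at hs
      exact hs
    simp only [Finset.mem_filter, Fintype.mem_piFinset, Finset.mem_range, Nat.lt_succ_iff]
    exact ⟨fun i => (Finset.single_le_sum (fun _ _ => Nat.zero_le _)
      (Finset.mem_univ i)).trans hs', hs'⟩
  refine Nat.card_le_card_of_injective (fun s => ⟨_, hmem s⟩) fun s t hst => ?_
  exact Subtype.ext (DFunLike.coe_injective (congrArg Subtype.val hst))

/-- The number of zero patterns of a system of polynomials is at most the dimension of a space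
containing their products. -/
theorem card_zeroPatterns_le {K σ ι : Type*} [Field K] [Fintype σ] [Fintype ι]
    (f : ι → MvPolynomial σ K) (d : ℕ) (hf : ∀ i, (f i).totalDegree ≤ d)
    (S : Finset (ι → Bool))
    (hS : ∀ P ∈ S, ∃ x : σ → K, ∀ i, MvPolynomial.eval x (f i) ≠ 0 ↔ P i = true) :
    S.card ≤ Module.finrank K (MvPolynomial.restrictTotalDegree σ K (d * Fintype.card ι)) := by
  classical
  choose! x hx using hS
  -- The product over the support of `Q` is nonzero at the witness of `P` exactly when `Q ≤ P`, so
  -- the evaluation matrix is triangular for inclusion.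
  let g : (ι → Bool) → MvPolynomial σ K := fun P => ∏ i with P i = true, f i
  have hg : ∀ P, g P ∈ MvPolynomial.restrictTotalDegree σ K (d * Fintype.card ι) := by
    intro P
    rw [MvPolynomial.mem_restrictTotalDegree]
    refine (MvPolynomial.totalDegree_finsetProd _ _).trans ?_
    refine (Finset.sum_le_card_nsmul _ _ d fun i _ => hf i).trans ?_
    rw [smul_eq_mul, mul_comm]
    exact Nat.mul_le_mul_left _ (Finset.card_le_univ _)
  have heval : ∀ P ∈ S, ∀ Q, MvPolynomial.eval (x P) (g Q) ≠ 0 ↔ Q ≤ P := by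
    intro P hP Q
    simp only [g, map_prod, Finset.prod_ne_zero_iff, Finset.mem_filter, Finset.mem_univ, true_and,
      hx P hP]
    exact Iff.rfl
  have hli : LinearIndependent K fun P : S => (⟨g P.1, hg P.1⟩ :
      MvPolynomial.restrictTotalDegree σ K (d * Fintype.card ι)) := by
    rw [Fintype.linearIndependent_iff]
    intro c hc
    by_contra! hne
    obtain ⟨P0, hP0⟩ := hne
    -- In a vanishing combination, evaluating at the witness of a minimal `P` with nonzero
    -- coefficient kills every term but that of `P`.
    obtain ⟨P, hP⟩ := (Finset.univ.filter fun P : S => c P ≠ 0).exists_minimal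
      ⟨P0, by simpa using hP0⟩
    have hcP : c P ≠ 0 := by simpa using hP.1
    have h0 := congrArg (fun q => MvPolynomial.eval (x P.1)
      (Submodule.subtype _ q : MvPolynomial σ K)) hc
    simp only [map_sum, map_smul, Submodule.subtype_apply, map_zero] at h0
    rw [Finset.sum_eq_single P] at h0
    · rw [MvPolynomial.smul_eval] at h0
      exact (mul_ne_zero hcP ((heval P.1 P.2 P.1).2 le_rfl)) h0
    · intro Q _ hQP
      rw [MvPolynomial.smul_eval]
      by_cases hcQ : c Q = 0
      · simp [hcQ]
      · have : ¬ Q.1 ≤ P.1 := fun hle =>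
          hQP (le_antisymm hle (hP.2 (by simpa using hcQ) hle))
        rw [← heval P.1 P.2, not_not] at this
        rw [this, mul_zero]
    · simp
  simpa using hli.fintype_card_le_finrank

/-- The number of zero-nonzero patterns of matrices of rank at most `k` over any field. -/
theorem card_patterns_le (K : Type u) [Field K] {n k : ℕ} [NeZero n] (S : Finset (BinMatrix n))
    (hS : ∀ R ∈ S, minRank K R ≤ k) {δ : ℝ} (h0 : 0 < δ) (h1 : δ ≤ 1 / 2) :
    (S.card : ℝ) ≤ Real.exp (2 * δ * (2 * (n * n) : ℕ)) * (1 / δ) ^ (2 * (n * k)) := by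
  classical
  let σ := Fin n × Fin k ⊕ Fin k × Fin n
  -- Entries of the product of a generic n×k and a generic k×n matrix.
  let f : Fin n × Fin n → MvPolynomial σ K := fun e =>
    ∑ l : Fin k, MvPolynomial.X (Sum.inl (e.1, l)) * MvPolynomial.X (Sum.inr (l, e.2))
  have hf : ∀ i, (f i).totalDegree ≤ 2 := by
    intro i
    refine MvPolynomial.totalDegree_finsetSum_le fun l _ => ?_
    refine (MvPolynomial.totalDegree_mul _ _).trans ?_
    simp
  have h := card_zeroPatterns_le f 2 hf
    (S.image fun R => fun e : Fin n × Fin n => R e.1 e.2) ?_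
  · rw [Finset.card_image_of_injective] at h
    · have h' := (Nat.cast_le (α := ℝ)).2 h
      refine h'.trans ((finrank_restrictTotalDegree_le K σ _ h0 h1).trans_eq ?_)
      simp only [σ, Fintype.card_prod, Fintype.card_fin, Fintype.card_sum]
      congr 2
      ring
    · intro R R' hRR
      funext a b
      exact congrFun hRR (a, b)
  · intro P hP
    obtain ⟨R, hR, rfl⟩ := Finset.mem_image.1 hP
    obtain ⟨M, hM, hr⟩ := exists_rank_eq_minRank K R
    obtain ⟨J, X, hX⟩ := exists_eq_submatrix_mul_of_rank_le M (hr.trans_le (hS R hR))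
    refine ⟨Sum.elim (fun a => M a.1 (J a.2)) fun b => X b.1 b.2, fun e => ?_⟩
    have he : MvPolynomial.eval (Sum.elim (fun a => M a.1 (J a.2)) fun b => X b.1 b.2) (f e) =
        M e.1 e.2 := by
      conv_rhs => rw [hX]
      simp [f, Matrix.mul_apply]
    rw [he, ← hM]
    simp [zeroNonzeroPattern]

/-! ### Counting partial orientations -/

/-- Supersets of a given size. -/
theorem card_supersets_of_card {E : Type*} [Fintype E] [DecidableEq E] (U : Finset E) {m : ℕ}
    (hm : U.card ≤ m) :
    (Finset.univ.filter fun s : Finset E => U ⊆ s ∧ s.card = m).card =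
      (Fintype.card E - U.card).choose (m - U.card) := by
  rw [← Finset.card_compl, ← Finset.card_powersetCard]
  refine Finset.card_bij' (fun s _ => s \ U) (fun s _ => s ∪ U) ?_ ?_ ?_ ?_
  · intro s hs
    simp only [Finset.mem_filter, Finset.mem_univ, true_and] at hs
    rw [Finset.mem_powersetCard, Finset.card_sdiff_of_subset hs.1, hs.2]
    exact ⟨fun x hx => by simpa using (Finset.mem_sdiff.1 hx).2, rfl⟩
  · intro s hs
    rw [Finset.mem_powersetCard] at hs
    have hd : Disjoint s U := Finset.disjoint_left.2 fun x hx => by simpa using hs.1 hx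
    simp only [Finset.mem_filter, Finset.mem_univ, true_and]
    refine ⟨Finset.subset_union_right, ?_⟩
    rw [Finset.card_union_of_disjoint hd, hs.2]
    omega
  · intro s hs
    simp only [Finset.mem_filter, Finset.mem_univ, true_and] at hs
    exact Finset.sdiff_union_of_subset hs.1
  · intro s hs
    rw [Finset.mem_powersetCard] at hs
    have hd : Disjoint s U := Finset.disjoint_left.2 fun x hx => by simpa using hs.1 hx
    exact Finset.union_sdiff_cancel_right hd

/-- Partial orientations with `m` oriented elements and prescribed values on `U`. -/
theorem card_partial_orientations {E : Type*} [Fintype E] [DecidableEq E] (U : Finset E)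
    (τ : E → Bool) {m : ℕ} (hm : U.card ≤ m) :
    (Finset.univ.filter fun g : E → Option Bool =>
      (Finset.univ.filter fun e => g e ≠ none).card = m ∧ ∀ e ∈ U, g e = some (τ e)).card =
      (Fintype.card E - U.card).choose (m - U.card) * 2 ^ (m - U.card) := by
  rw [← card_supersets_of_card U hm, ← smul_eq_mul, ← Finset.sum_const]
  -- Fibre over the set `s` of oriented elements: those in `s \ U` have two free values, all others
  -- are forced.
  rw [Finset.card_eq_sum_card_fiberwise (f := fun g => Finset.univ.filter fun e => g e ≠ none)
    (t := Finset.univ.filter fun s : Finset E => U ⊆ s ∧ s.card = m)]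
  · refine Finset.sum_congr rfl fun s hs => ?_
    simp only [Finset.mem_filter, Finset.mem_univ, true_and] at hs
    have hfib : ((Finset.univ.filter fun g : E → Option Bool =>
        (Finset.univ.filter fun e => g e ≠ none).card = m ∧ ∀ e ∈ U, g e = some (τ e)).filter
          fun g => (Finset.univ.filter fun e => g e ≠ none) = s) =
        Fintype.piFinset fun e => if e ∈ U then {some (τ e)} else
          if e ∈ s then {some true, some false} else {none} := by
      ext g
      simp only [Finset.mem_filter, Finset.mem_univ, true_and, Fintype.mem_piFinset]
      constructor
      · rintro ⟨⟨-, h2⟩, rfl⟩ e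
        by_cases he : e ∈ U
        · simp [he, h2 e he]
        · cases hge : g e with
          | none => simp [he, hge]
          | some b => cases b <;> simp [he, hge]
      · intro h
        have hs' : (Finset.univ.filter fun e => g e ≠ none) = s := by
          ext e
          have := h e
          by_cases he : e ∈ U
          · simp only [he, if_true, Finset.mem_singleton] at this
            simp [this, hs.1 he]
          · by_cases hes : e ∈ s
            · simp only [he, hes, if_true, if_false, Finset.mem_insert,
                Finset.mem_singleton] at this
              rcases this with h | h <;> simp [h, hes]
            · simp only [he, hes, if_false, Finset.mem_singleton] at this
              simp [this, hes]
        refine ⟨⟨hs' ▸ hs.2, fun e he => ?_⟩, hs'⟩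
        simpa [he] using h e
    rw [hfib, Fintype.card_piFinset]
    have : ∀ e, (if e ∈ U then ({some (τ e)} : Finset (Option Bool)) else
          if e ∈ s then {some true, some false} else {none}).card =
        if e ∈ s \ U then 2 else 1 := by
      intro e
      by_cases he : e ∈ U
      · simp [he]
      · by_cases hes : e ∈ s <;> simp [he, hes]
    simp only [this]
    rw [Finset.prod_ite_mem]
    simp [Finset.card_sdiff_of_subset hs.1, hs.2]
  · intro g hg
    simp only [Finset.coe_filter, Finset.mem_univ, true_and, Set.mem_ofPred_eq] at hg ⊢
    refine ⟨fun e he => ?_, hg.1⟩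
    simp [hg.2 e he]

/-- The ratio of the two binomials is the product of (m - i)/(N - i) over i < j, and each factor is
at most m/N. Cross-multiplication keeps the induction in ℕ. -/
theorem choose_sub_mul_pow_le (N m : ℕ) (hmN : m ≤ N) : ∀ j, j ≤ m →
    (N - j).choose (m - j) * N ^ j ≤ m ^ j * N.choose m
  | 0, _ => by simp
  | j + 1, hj => by
    have ih := choose_sub_mul_pow_le N m hmN j (by omega)
    have h1 : (N - j) * (N - (j + 1)).choose (m - (j + 1)) =
        (N - j).choose (m - j) * (m - j) := by
      have := Nat.add_one_mul_choose_eq (N - (j + 1)) (m - (j + 1))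
      rwa [show N - (j + 1) + 1 = N - j by omega, show m - (j + 1) + 1 = m - j by omega] at this
    have h2 : (m - j) * N ≤ m * (N - j) := by
      obtain ⟨a, rfl⟩ := Nat.exists_eq_add_of_le hmN
      obtain ⟨b, rfl⟩ := Nat.exists_eq_add_of_le (show j ≤ m by omega)
      rw [show j + b - j = b by omega, show j + b + a - j = b + a by omega]
      nlinarith [Nat.zero_le (j * a)]
    have hpos : 0 < N - j := by omega
    refine Nat.le_of_mul_le_mul_left ?_ hpos
    calc (N - j) * ((N - (j + 1)).choose (m - (j + 1)) * N ^ (j + 1))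
        = ((m - j) * N) * ((N - j).choose (m - j) * N ^ j) := by
          rw [← mul_assoc, h1]; ring
      _ ≤ (m * (N - j)) * (m ^ j * N.choose m) := Nat.mul_le_mul h2 ih
      _ = _ := by ring

/-! ### Fooling-set patterns as partial orientations of pairs -/

/-- The unordered pairs of distinct indices, represented in increasing order. -/
abbrev IncPair (n : ℕ) : Type := {e : Fin n × Fin n // e.1 < e.2}

theorem card_incPair (n : ℕ) : Fintype.card (IncPair n) = n.choose 2 := by
  have h1 : (Finset.univ.filter fun e : Fin n × Fin n => e.1 < e.2).card =
      (Finset.univ.filter fun e : Fin n × Fin n => e.2 < e.1).card :=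
    Finset.card_bij (fun e _ => e.swap) (by simp) (by simp) 
      fun b hb => ⟨b.swap, by simpa using hb, by simp⟩
  have h2 : (Finset.univ : Finset (Fin n)).offDiag =
      (Finset.univ.filter fun e : Fin n × Fin n => e.1 < e.2) ∪
      (Finset.univ.filter fun e : Fin n × Fin n => e.2 < e.1) := by
    ext e
    simp [lt_or_lt_iff_ne]
  have h3 := Finset.offDiag_card (Finset.univ : Finset (Fin n))
  rw [h2, Finset.card_union_of_disjoint, ← h1] at h3
  · rw [Fintype.card_subtype, Nat.choose_two_right]
    simp only [Finset.card_univ, Fintype.card_fin] at h3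
    rw [Nat.mul_sub, mul_one]
    omega
  · refine Finset.disjoint_left.2 fun e he he' => ?_
    simp only [Finset.mem_filter, Finset.mem_univ, true_and] at he he'
    exact lt_asymm he he'

/-- The pattern of a partial orientation. -/
def toPattern {n : ℕ} (g : IncPair n → Option Bool) : BinMatrix n := fun i j =>
  if h : i < j then decide (g ⟨(i, j), h⟩ = some true)
  else if h : j < i then decide (g ⟨(j, i), h⟩ = some false) else true

/-- The partial orientation of a pattern. -/
def ofPattern {n : ℕ} (R : BinMatrix n) : IncPair n → Option Bool := fun e =>
  if R e.1.1 e.1.2 then some true else if R e.1.2 e.1.1 then some false else none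

theorem ofPattern_toPattern {n : ℕ} (g : IncPair n → Option Bool) :
    ofPattern (toPattern g) = g := by
  funext ⟨⟨i, j⟩, h⟩
  have h : i < j := h
  have h' : ¬ j < i := h.asymm
  simp only [ofPattern, toPattern, h, h', dif_pos, dif_neg, not_false_eq_true]
  rcases g ⟨(i, j), h⟩ with _ | _ | _ <;> simp

theorem toPattern_ofPattern {n : ℕ} {R : BinMatrix n} (hR : IsFoolingPattern R) :
    toPattern (ofPattern R) = R := by
  funext i j
  rcases lt_trichotomy i j with h | rfl | h
  · simp only [ofPattern, toPattern, h, dif_pos]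
    cases h1 : R i j <;> cases h2 : R j i <;> simp
  · simp [toPattern, hR.1]
  · have h' : ¬ i < j := h.asymm
    have := hR.2 i j h.ne'
    simp only [ofPattern, toPattern, h, h', dif_pos, dif_neg, not_false_eq_true]
    cases h1 : R i j <;> cases h2 : R j i <;> simp_all

theorem isFoolingPattern_toPattern {n : ℕ} (g : IncPair n → Option Bool) :
    IsFoolingPattern (toPattern g) := by
  refine ⟨fun k => by simp [toPattern], fun k l hkl => ?_⟩
  rcases lt_or_gt_of_ne hkl with h | h
  · have h' : ¬ l < k := h.asymm
    simp only [toPattern, h, h', dif_pos, dif_neg, not_false_eq_true]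
    rcases g ⟨(k, l), h⟩ with _ | _ | _ <;> simp
  · have h' : ¬ k < l := h.asymm
    simp only [toPattern, h, h', dif_pos, dif_neg, not_false_eq_true]
    rcases g ⟨(l, k), h⟩ with _ | _ | _ <;> simp

theorem offDiagOnes_eq_card_ofPattern {n : ℕ} {R : BinMatrix n} (hR : IsFoolingPattern R) :
    offDiagOnes R = (Finset.univ.filter fun e => ofPattern R e ≠ none).card := by
  symm
  -- An oriented pair carries exactly one one, in one of two mirror positions; it is sent to that
  -- position.
  refine Finset.card_bij (fun e _ => if R e.1.1 e.1.2 then e.1 else e.1.swap) ?_ ?_ ?_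
  · rintro ⟨⟨i, j⟩, h⟩ he
    have h : i < j := h
    replace he := (Finset.mem_filter.1 he).2
    simp only [ofPattern] at he
    simp only [Finset.mem_filter, Finset.mem_univ, true_and]
    cases h1 : R i j
    · cases h2 : R j i
      · simp [h1, h2] at he
      · simp [h2, h.ne']
    · simp [h1, h.ne]
  · rintro ⟨⟨i, j⟩, h⟩ - ⟨⟨i', j'⟩, h'⟩ - heq
    have h : i < j := h
    have h' : i' < j' := h'
    simp only at heq
    split_ifs at heq
    · exact Subtype.ext heq
    · simp only [Prod.swap_prod_mk, Prod.mk.injEq] at heq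
      obtain ⟨rfl, rfl⟩ := heq
      exact absurd h h'.asymm
    · simp only [Prod.swap_prod_mk, Prod.mk.injEq] at heq
      obtain ⟨rfl, rfl⟩ := heq
      exact absurd h h'.asymm
    · simp only [Prod.swap_prod_mk, Prod.mk.injEq] at heq
      obtain ⟨rfl, rfl⟩ := heq
      rfl
  · rintro ⟨i, j⟩ hij
    simp only [Finset.mem_filter, Finset.mem_univ, true_and] at hij
    rcases lt_or_gt_of_ne hij.1 with h | h
    · exact ⟨⟨(i, j), h⟩, Finset.mem_filter.2 ⟨Finset.mem_univ _, by simp [ofPattern, hij.2]⟩, by simp [hij.2]⟩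
    · have := hR.2 i j hij.1
      rw [hij.2, Bool.true_and] at this
      exact ⟨⟨(j, i), h⟩, Finset.mem_filter.2 ⟨Finset.mem_univ _, by simp [ofPattern, hij.2, this]⟩,
        by simp [this]⟩

open Classical in
/-- The fooling-set patterns with exactly `m` off-diagonal ones. -/
noncomputable def foolingWith (n m : ℕ) : Finset (BinMatrix n) :=
  Finset.univ.filter fun R => IsFoolingPattern R ∧ offDiagOnes R = m

theorem card_foolingWith (n m : ℕ) : (foolingWith n m).card = (n.choose 2).choose m * 2 ^ m := by
  classical
  have h := card_partial_orientations (E := IncPair n) ∅ (fun _ => true) (Nat.zero_le m)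
  simp only [Finset.card_empty, Nat.sub_zero, card_incPair] at h
  rw [← h]
  refine Finset.card_bij' (fun R _ => ofPattern R) (fun g _ => toPattern g) ?_ ?_ ?_ ?_
  · intro R hR
    simp only [foolingWith, Finset.mem_filter, Finset.mem_univ, true_and] at hR ⊢
    exact ⟨by rw [← offDiagOnes_eq_card_ofPattern hR.1, hR.2], by simp⟩
  · intro g hg
    simp only [foolingWith, Finset.mem_filter, Finset.mem_univ, true_and] at hg ⊢
    refine ⟨isFoolingPattern_toPattern g, ?_⟩
    rw [offDiagOnes_eq_card_ofPattern (isFoolingPattern_toPattern g), ofPattern_toPattern, hg.1]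
  · intro R hR
    simp only [foolingWith, Finset.mem_filter, Finset.mem_univ, true_and] at hR
    exact toPattern_ofPattern hR.1
  · intro g _
    exact ofPattern_toPattern g

open Classical in
/-- A uniformly random pattern with `m` ones contains a given set of `j` positions with
probability at most `(m / (2 * n.choose 2)) ^ j`. -/
theorem card_foolingWith_containing_le {n m : ℕ} (T : Finset (Fin n × Fin n))
    (hT : ∀ e ∈ T, e.1 ≠ e.2) :
    ((foolingWith n m).filter fun R => ∀ e ∈ T, R e.1 e.2 = true).card *
        (2 * n.choose 2) ^ T.card ≤ m ^ T.card * (foolingWith n m).card := by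
  -- If some pattern `R0` contains `T`, then `T` has no two mirror positions and at most `m`
  -- elements; otherwise the count is 0.
  rcases Finset.eq_empty_or_nonempty
    ((foolingWith n m).filter fun R => ∀ e ∈ T, R e.1 e.2 = true) with h | ⟨R0, hR0⟩
  · rw [h]; simp
  simp only [foolingWith, Finset.mem_filter, Finset.mem_univ, true_and] at hR0
  obtain ⟨⟨hF, hm⟩, hT0⟩ := hR0
  let u : Fin n × Fin n → Fin n × Fin n := fun e => if e.1 < e.2 then e else e.swap
  have hu : ∀ e ∈ T, (u e).1 < (u e).2 := by
    intro e he
    simp only [u]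
    split_ifs with h
    · exact h
    · exact lt_of_le_of_ne (not_lt.1 h) (hT e he).symm
  let U : Finset (IncPair n) := T.attach.image fun e => ⟨u e.1, hu e.1 e.2⟩
  have hinj : Set.InjOn u T := by
    rintro ⟨i, j⟩ h1 ⟨i', j'⟩ h2 heq
    have hR1 := hT0 _ h1
    have hR2 := hT0 _ h2
    have hF1 := hF.2 i j (hT _ h1)
    simp only [u] at heq
    simp only at hR1 hR2
    split_ifs at heq
    · exact heq
    · simp only [Prod.swap_prod_mk, Prod.mk.injEq] at heq
      obtain ⟨rfl, rfl⟩ := heq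
      simp [hR1, hR2] at hF1
    · simp only [Prod.swap_prod_mk, Prod.mk.injEq] at heq
      obtain ⟨rfl, rfl⟩ := heq
      simp [hR1, hR2] at hF1
    · simp only [Prod.swap_prod_mk, Prod.mk.injEq] at heq
      obtain ⟨rfl, rfl⟩ := heq
      rfl
  have hU : U.card = T.card := by
    rw [Finset.card_image_of_injective, Finset.card_attach]
    intro a b hab
    exact Subtype.ext (hinj a.2 b.2 (congrArg Subtype.val hab))
  -- The positions in `T` force the orientation on `U`, which can be read off from `R0`.
  let τ : IncPair n → Bool := fun e => R0 e.1.1 e.1.2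
  have hval : ∀ R : BinMatrix n, IsFoolingPattern R → (∀ e ∈ T, R e.1 e.2 = true) →
      ∀ e ∈ U, ofPattern R e = some (τ e) := by
    intro R hRF hR e he
    obtain ⟨⟨⟨i, j⟩, hij⟩, -, rfl⟩ := Finset.mem_image.1 he
    have h1 := hR _ hij
    have h2 := hT0 _ hij
    have h3 := hRF.2 i j (hT _ hij)
    have h4 := hF.2 i j (hT _ hij)
    simp only at h1 h2
    rw [h1, Bool.true_and] at h3
    rw [h2, Bool.true_and] at h4
    by_cases hlt : i < j <;> simp [ofPattern, τ, u, hlt, h1, h2, h3, h4]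
  have hUm : U.card ≤ m := by
    rw [← hm, offDiagOnes_eq_card_ofPattern hF]
    refine Finset.card_le_card fun e he => ?_
    simp [hval R0 hF hT0 e he]
  have hmN : m ≤ n.choose 2 := by
    rw [← hm, offDiagOnes_eq_card_ofPattern hF, ← card_incPair]
    exact Finset.card_le_univ _
  have hle : ((foolingWith n m).filter fun R => ∀ e ∈ T, R e.1 e.2 = true).card ≤
      (n.choose 2 - T.card).choose (m - T.card) * 2 ^ (m - T.card) := by
    have hc := card_partial_orientations U τ hUm
    rw [hU, card_incPair] at hc
    rw [← hc]
    refine Finset.card_le_card_of_injOn ofPattern ?_ ?_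
    · intro R hR
      simp only [foolingWith, Finset.coe_filter, Finset.mem_filter, Finset.mem_univ, true_and,
        Set.mem_ofPred_eq] at hR ⊢
      exact ⟨by rw [← offDiagOnes_eq_card_ofPattern hR.1.1, hR.1.2], hval R hR.1.1 hR.2⟩
    · intro R hR R' hR' heq
      simp only [foolingWith, Finset.coe_filter, Finset.mem_filter, Finset.mem_univ, true_and,
        Set.mem_ofPred_eq] at hR hR'
      rw [← toPattern_ofPattern hR.1.1, heq, toPattern_ofPattern hR'.1.1]
  rw [hU] at hUm
  refine (Nat.mul_le_mul_right _ hle).trans ?_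
  rw [card_foolingWith]
  have h := choose_sub_mul_pow_le _ m hmN T.card hUm
  calc _ = ((n.choose 2 - T.card).choose (m - T.card) * n.choose 2 ^ T.card) *
        (2 ^ (m - T.card) * 2 ^ T.card) := by rw [mul_pow]; ring
    _ ≤ (m ^ T.card * (n.choose 2).choose m) * 2 ^ m := by
      rw [← pow_add, Nat.sub_add_cancel hUm]
      exact Nat.mul_le_mul_right _ h
    _ = _ := by ring

/-! ### Low-degree indices and diagonal submatrices -/

/-- The number of off-diagonal ones in the row and in the column of an index. -/
def touchDegree {n : ℕ} (R : BinMatrix n) (v : Fin n) : ℕ :=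
  (Finset.univ.filter fun l => v ≠ l ∧ R v l = true).card +
    (Finset.univ.filter fun l => l ≠ v ∧ R l v = true).card

theorem sum_touchDegree {n : ℕ} (R : BinMatrix n) :
    ∑ v, touchDegree R v = 2 * offDiagOnes R := by
  have h1 : offDiagOnes R = ∑ v, (Finset.univ.filter fun l => v ≠ l ∧ R v l = true).card := by
    simp only [offDiagOnes, Finset.card_filter, Fintype.sum_prod_type]
  have h2 : offDiagOnes R = ∑ v, (Finset.univ.filter fun l => l ≠ v ∧ R l v = true).card := by
    simp only [offDiagOnes, Finset.card_filter, Fintype.sum_prod_type]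
    exact Finset.sum_comm
  simp only [touchDegree, Finset.sum_add_distrib]
  rw [← h1, ← h2, two_mul]

theorem mul_card_high_touchDegree_le {n : ℕ} (R : BinMatrix n) (d : ℕ) :
    d * (Finset.univ.filter fun v => d ≤ touchDegree R v).card ≤ 2 * offDiagOnes R := by
  rw [← sum_touchDegree, mul_comm, ← smul_eq_mul]
  refine (Finset.card_nsmul_le_sum _ (touchDegree R) d fun v hv =>
    (Finset.mem_filter.1 hv).2).trans ?_
  exact Finset.sum_le_sum_of_subset (Finset.filter_subset _ _)

/-- A maximal independent set among the indices of low degree bounds the minimum rank. -/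
theorem le_minRank_mul_add (K : Type u) [Field K] {n : ℕ} {R : BinMatrix n}
    (hR : ∀ k, R k k = true) (d : ℕ) :
    n ≤ minRank K R * d + (Finset.univ.filter fun v => d ≤ touchDegree R v).card := by
  classical
  let L := Finset.univ.filter fun v => ¬ d ≤ touchDegree R v
  have hn : L.card + (Finset.univ.filter fun v => d ≤ touchDegree R v).card = n := by
    have := Finset.card_filter_add_card_filter_not (s := (Finset.univ : Finset (Fin n)))
      (fun v => d ≤ touchDegree R v)
    rw [Finset.card_univ, Fintype.card_fin] at this
    rw [add_comm]
    exact this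
  obtain ⟨I, hI⟩ := (L.powerset.filter fun I : Finset (Fin n) =>
    ∀ i ∈ I, ∀ j ∈ I, i ≠ j → R i j = false).exists_maximal ⟨∅, by simp⟩
  have hI1 := (Finset.mem_filter.1 hI.1).1
  have hI2 := (Finset.mem_filter.1 hI.1).2
  rw [Finset.mem_powerset] at hI1
  have hrank : I.card ≤ minRank K R := by
    obtain ⟨M, hM, hr⟩ := exists_rank_eq_minRank K R
    rw [← hr]
    have hz : ∀ i j, R i j = true ↔ M i j ≠ 0 := fun i j => by
      rw [← hM]; simp [zeroNonzeroPattern]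
    refine card_le_rank_of_diagonal M I (fun i _ => (hz i i).1 (hR i)) fun i hi j hj hij => ?_
    by_contra h
    have := (hz i j).2 h
    rw [hI2 i hi j hj hij] at this
    exact absurd this (by simp)
  -- Closed neighbourhoods: fewer than `d` neighbours plus `v` itself, hence at most `d` elements.
  -- By maximality of `I` they cover `L`.
  let B : Fin n → Finset (Fin n) := fun v => insert v
    ((Finset.univ.filter fun l => v ≠ l ∧ R v l = true) ∪
      (Finset.univ.filter fun l => l ≠ v ∧ R l v = true))
  have hB : ∀ v ∈ I, (B v).card ≤ d := by
    intro v hv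
    have h1 : ¬ d ≤ touchDegree R v := (Finset.mem_filter.1 (hI1 hv)).2
    have h2 := Finset.card_insert_le v
      ((Finset.univ.filter fun l => v ≠ l ∧ R v l = true) ∪
      (Finset.univ.filter fun l => l ≠ v ∧ R l v = true))
    have h3 := Finset.card_union_le (Finset.univ.filter fun l => v ≠ l ∧ R v l = true)
      (Finset.univ.filter fun l => l ≠ v ∧ R l v = true)
    simp only [touchDegree] at h1
    simp only [B]
    omega
  have hLB : L ⊆ I.biUnion B := by
    intro v hv
    by_contra hcon
    simp only [Finset.mem_biUnion, not_exists, not_and] at hcon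
    have hvI : v ∉ I := fun h => hcon v h (Finset.mem_insert_self _ _)
    have hnb : ∀ i ∈ I, R i v = false ∧ R v i = false := by
      intro i hi
      have hne : i ≠ v := fun h => hvI (h ▸ hi)
      have := hcon i hi
      simp only [B, Finset.mem_insert, Finset.mem_union, Finset.mem_filter, Finset.mem_univ,
        true_and, not_or, not_and, Bool.not_eq_true] at this
      exact ⟨this.2.1 hne, this.2.2 hne.symm⟩
    have hmem : insert v I ∈ L.powerset.filter fun I : Finset (Fin n) =>
        ∀ i ∈ I, ∀ j ∈ I, i ≠ j → R i j = false := by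
      rw [Finset.mem_filter, Finset.mem_powerset]
      refine ⟨Finset.insert_subset hv hI1, ?_⟩
      intro i hi j hj hij
      rcases Finset.mem_insert.1 hi with rfl | hi'
      · rcases Finset.mem_insert.1 hj with rfl | hj'
        · exact absurd rfl hij
        · exact (hnb j hj').2
      · rcases Finset.mem_insert.1 hj with rfl | hj'
        · exact (hnb i hi').1
        · exact hI2 i hi' j hj' hij
    exact hvI (hI.2 hmem (Finset.subset_insert _ _) (Finset.mem_insert_self _ _))
  have hcard : L.card ≤ I.card * d :=
    (Finset.card_le_card hLB).trans (Finset.card_biUnion_le_card_mul _ _ _ hB)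
  have := Nat.mul_le_mul_right d hrank
  omega

/-! ### Sparse matrices of low rank over a finite field -/

open Classical in
/-- The vectors with at most `d` nonzero entries. -/
noncomputable def sparseVectors (K : Type*) [Field K] [Fintype K] (n d : ℕ) :
    Finset (Fin n → K) :=
  Finset.univ.filter fun v => (Finset.univ.filter fun i => v i ≠ 0).card ≤ d

/-- Weight each nonzero entry by x = p/F, where F is the field size. A sparse vector then weighs at
least x^d, while all vectors together weigh at most (1 + Fx)^n ≤ e^(np). -/
theorem card_sparseVectors_le (K : Type*) [Field K] [Fintype K] (n d : ℕ) {p : ℝ} (h0 : 0 < p)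
    (h1 : p ≤ 1) :
    ((sparseVectors K n d).card : ℝ) ≤ (Fintype.card K / p) ^ d * Real.exp (n * p) := by
  classical
  set F : ℝ := (Fintype.card K : ℝ) with hF
  have hF1 : 1 ≤ F := by rw [hF]; exact_mod_cast Fintype.card_pos
  have hF0 : 0 < F := by linarith
  set x : ℝ := p / F with hx
  have hx0 : 0 < x := by positivity
  have hx1 : x ≤ 1 := by rw [hx, div_le_one hF0]; linarith
  have key : ((sparseVectors K n d).card : ℝ) * x ^ d ≤ Real.exp (n * p) := by
    calc _ = ∑ v ∈ sparseVectors K n d, x ^ d := by simp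
      _ ≤ ∑ v ∈ sparseVectors K n d, ∏ i, (if v i = 0 then 1 else x) := by
        refine Finset.sum_le_sum fun v hv => ?_
        rw [Finset.prod_ite]
        simp only [Finset.prod_const, one_pow, one_mul]
        exact pow_le_pow_of_le_one hx0.le hx1 (Finset.mem_filter.1 hv).2
      _ ≤ ∑ v : Fin n → K, ∏ i, (if v i = 0 then 1 else x) :=
        Finset.sum_le_sum_of_subset_of_nonneg (Finset.subset_univ _)
          fun v _ _ => Finset.prod_nonneg fun i _ => by split_ifs <;> positivity
      _ = (∑ a : K, if a = 0 then 1 else x) ^ n := by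
        rw [← Fintype.piFinset_univ,
          Finset.sum_prod_piFinset (Finset.univ : Finset K) (fun _ a => if a = 0 then 1 else x)]
        simp
      _ ≤ (1 + F * x) ^ n := by
        refine pow_le_pow_left₀ (Finset.sum_nonneg fun a _ => by split_ifs <;> positivity) ?_ n
        calc _ ≤ ∑ a : K, ((if a = 0 then 1 else 0) + x) :=
              Finset.sum_le_sum fun a _ => by split_ifs <;> linarith
          _ = _ := by rw [Finset.sum_add_distrib]; simp [hF]
      _ ≤ Real.exp (F * x) ^ n := by
        refine pow_le_pow_left₀ (by positivity) ?_ n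
        linarith [Real.add_one_le_exp (F * x)]
      _ = _ := by
        rw [← Real.exp_nat_mul, hx, mul_div_cancel₀ _ hF0.ne']
  have h2 : (F / p) ^ d = (x ^ d)⁻¹ := by rw [hx, ← inv_pow, inv_div]
  rw [h2, inv_mul_eq_div, le_div_iff₀ (by positivity)]
  exact key

open Classical in
/-- The matrices of rank at most `k` with at most `d` nonzero entries in each row and column. -/
noncomputable def sparseLowRank (K : Type*) [Field K] [Fintype K] (n d k : ℕ) :
    Finset (Matrix (Fin n) (Fin n) K) :=
  Finset.univ.filter fun M => M.rank ≤ k ∧ (∀ i, M i ∈ sparseVectors K n d) ∧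
    ∀ l, (fun i => M i l) ∈ sparseVectors K n d

/-- By `eq_of_submatrix_eq`, the places and contents of k spanning rows and k spanning columns
encode the matrix, and each of these 2k vectors is sparse. -/
theorem card_sparseLowRank_le (K : Type*) [Field K] [Fintype K] (n d k : ℕ) [NeZero n] :
    (sparseLowRank K n d k).card ≤ (n * n * ((sparseVectors K n d).card *
      (sparseVectors K n d).card)) ^ k := by
  classical
  have hc : ∀ M : Matrix (Fin n) (Fin n) K, ∃ I J : Fin k → Fin n, M.rank ≤ k →
      (∃ X, M = M.submatrix id J * X) ∧ ∃ Y, M = Y * M.submatrix I id := by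
    intro M
    by_cases h : M.rank ≤ k
    · obtain ⟨J, X, hX⟩ := exists_eq_submatrix_mul_of_rank_le M h
      obtain ⟨I, Y, hY⟩ := exists_eq_mul_submatrix_of_rank_le M h
      exact ⟨I, J, fun _ => ⟨⟨X, hX⟩, ⟨Y, hY⟩⟩⟩
    · exact ⟨fun _ => 0, fun _ => 0, fun h' => absurd h' h⟩
  choose I J hIJ using hc
  let V := sparseVectors K n d
  have hcard : Fintype.card ((Fin k → Fin n) × (Fin k → Fin n) × (Fin k → V) × (Fin k → V)) =
      (n * n * ((sparseVectors K n d).card * (sparseVectors K n d).card)) ^ k := by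
    simp only [Fintype.card_prod, Fintype.card_fun, Fintype.card_fin, Fintype.card_coe, V]
    ring
  rw [← hcard, ← Fintype.card_coe]
  refine Fintype.card_le_of_injective (fun M => (I M.1, J M.1,
    fun a => ⟨M.1 (I M.1 a), (Finset.mem_filter.1 M.2).2.2.1 _⟩,
    fun a => ⟨fun i => M.1 i (J M.1 a), (Finset.mem_filter.1 M.2).2.2.2 _⟩)) ?_
  rintro ⟨M, hM⟩ ⟨M', hM'⟩ h
  simp only [Prod.mk.injEq] at h
  obtain ⟨hI, hJ, hr, hcol⟩ := h
  obtain ⟨⟨X, hX⟩, Y, hY⟩ := hIJ M (Finset.mem_filter.1 hM).2.1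
  obtain ⟨⟨X', hX'⟩, -⟩ := hIJ M' (Finset.mem_filter.1 hM').2.1
  rw [← hJ] at hX'
  refine Subtype.ext (eq_of_submatrix_eq hX hX' hY ?_ ?_)
  · ext i a
    have := congrFun (congrArg Subtype.val (congrFun hcol a)) i
    simpa [← hJ] using this
  · ext a i
    have := congrFun (congrArg Subtype.val (congrFun hr a)) i
    simpa [← hI] using this

/-! ### The union bound for small minimum rank -/

open Classical in
/-- The union bound over sets of `j` positions. -/
theorem card_mul_pow_le_of_forall_exists {n m j : ℕ} (bad : Finset (BinMatrix n))
    (hbad : bad ⊆ foolingWith n m) (𝒯 : Finset (Finset (Fin n × Fin n)))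
    (h : ∀ R ∈ bad, ∃ T ∈ 𝒯, T.card = j ∧ ∀ e ∈ T, e.1 ≠ e.2 ∧ R e.1 e.2 = true) :
    bad.card * (2 * n.choose 2) ^ j ≤ 𝒯.card * (m ^ j * (foolingWith n m).card) := by
  let 𝒯' := 𝒯.filter fun T => T.card = j ∧ ∀ e ∈ T, e.1 ≠ e.2
  have hsub : bad ⊆ 𝒯'.biUnion fun T =>
      (foolingWith n m).filter fun R => ∀ e ∈ T, R e.1 e.2 = true := by
    intro R hR
    obtain ⟨T, hT, hTj, hTR⟩ := h R hR
    rw [Finset.mem_biUnion]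
    exact ⟨T, Finset.mem_filter.2 ⟨hT, hTj, fun e he => (hTR e he).1⟩,
      Finset.mem_filter.2 ⟨hbad hR, fun e he => (hTR e he).2⟩⟩
  calc bad.card * (2 * n.choose 2) ^ j
      ≤ (∑ T ∈ 𝒯', ((foolingWith n m).filter fun R => ∀ e ∈ T, R e.1 e.2 = true).card) *
        (2 * n.choose 2) ^ j :=
        Nat.mul_le_mul_right _ ((Finset.card_le_card hsub).trans Finset.card_biUnion_le)
    _ = ∑ T ∈ 𝒯', ((foolingWith n m).filter fun R => ∀ e ∈ T, R e.1 e.2 = true).card *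
        (2 * n.choose 2) ^ j := Finset.sum_mul _ _ _
    _ ≤ ∑ T ∈ 𝒯', m ^ j * (foolingWith n m).card := by
        refine Finset.sum_le_sum fun T hT => ?_
        obtain ⟨-, hTj, hTo⟩ := Finset.mem_filter.1 hT
        have := card_foolingWith_containing_le (m := m) T hTo
        rwa [hTj] at this
    _ ≤ _ := by
        rw [Finset.sum_const, smul_eq_mul]
        exact Nat.mul_le_mul_right _ (Finset.card_filter_le _ _)

/-- Counting fooling-set patterns of small minimum rank over a finite field: either many ones
lie in rows and columns of the few indices of high degree, or deleting these indices leaves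
a sparse matrix of low rank with many ones. -/
theorem card_minRank_le_mul_pow_le (K : Type u) [Field K] [Fintype K] {n m d k s : ℕ} [NeZero n]
    (bad : Finset (BinMatrix n)) (hbad : bad ⊆ foolingWith n m)
    (hk : ∀ R ∈ bad, minRank K R ≤ k) (hs : 2 * m < d * (s + 1)) :
    bad.card * (2 * n.choose 2) ^ ((m + 1) / 2) ≤
      (2 ^ n * (2 * (s * n)).choose ((m + 1) / 2) +
        (n * n * ((sparseVectors K n d).card * (sparseVectors K n d).card)) ^ k) *
      (m ^ ((m + 1) / 2) * (foolingWith n m).card) := by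
  classical
  set j := (m + 1) / 2 with hj
  have hch : ∀ X : Finset (Fin n × Fin n), ∃ Y : Finset (Fin n × Fin n),
      j ≤ X.card → Y ⊆ X ∧ Y.card = j := by
    intro X
    by_cases h : j ≤ X.card
    · obtain ⟨Y, hY⟩ := Finset.exists_subset_card_eq h
      exact ⟨Y, fun _ => hY⟩
    · exact ⟨∅, fun h' => absurd h' h⟩
  -- `ch` selects `j` elements of any set that has so many, so each matrix contributes a single set
  -- to the union bound.
  choose ch hch using hch
  let near : Finset (Fin n) → Finset (Fin n × Fin n) := fun S =>
    Finset.univ.filter fun e => e.1 ∈ S ∨ e.2 ∈ S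
  have hnear : ∀ S : Finset (Fin n), (near S).card ≤ 2 * (S.card * n) := by
    intro S
    have : near S ⊆ S ×ˢ Finset.univ ∪ Finset.univ ×ˢ S := by
      intro e he
      simpa [near] using he
    refine (Finset.card_le_card this).trans ((Finset.card_union_le _ _).trans_eq ?_)
    simp only [Finset.card_product, Finset.card_univ, Fintype.card_fin]
    ring
  let 𝒜 : Finset (Finset (Fin n × Fin n)) :=
    ((Finset.univ : Finset (Finset (Fin n))).filter fun S => S.card ≤ s).biUnion
      fun S => (near S).powersetCard j
  let ℬ : Finset (Finset (Fin n × Fin n)) := (sparseLowRank K n d k).image fun M =>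
    ch (Finset.univ.filter fun e => e.1 ≠ e.2 ∧ M e.1 e.2 ≠ 0)
  have h𝒜 : 𝒜.card ≤ 2 ^ n * (2 * (s * n)).choose j := by
    refine (Finset.card_biUnion_le_card_mul _ _ ((2 * (s * n)).choose j) fun S hS => ?_).trans ?_
    · rw [Finset.card_powersetCard]
      refine Nat.choose_le_choose _ ((hnear S).trans ?_)
      exact Nat.mul_le_mul_left _ (Nat.mul_le_mul_right _ (Finset.mem_filter.1 hS).2)
    · refine Nat.mul_le_mul_right _ ((Finset.card_filter_le _ _).trans_eq ?_)
      simp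
  have hℬ : ℬ.card ≤ (n * n * ((sparseVectors K n d).card * (sparseVectors K n d).card)) ^ k :=
    Finset.card_image_le.trans (card_sparseLowRank_le K n d k)
  refine (card_mul_pow_le_of_forall_exists bad hbad (𝒜 ∪ ℬ) ?_).trans
    (Nat.mul_le_mul_right _ ((Finset.card_union_le _ _).trans (Nat.add_le_add h𝒜 hℬ)))
  intro R hR
  have hRm : offDiagOnes R = m := (Finset.mem_filter.1 (hbad hR)).2.2
  let S := Finset.univ.filter fun v => d ≤ touchDegree R v
  have hS : S.card ≤ s := by
    have h := mul_card_high_touchDegree_le R d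
    rw [hRm] at h
    exact Nat.lt_succ_iff.1 (Nat.lt_of_mul_lt_mul_left (h.trans_lt hs))
  let ones := Finset.univ.filter fun e : Fin n × Fin n => e.1 ≠ e.2 ∧ R e.1 e.2 = true
  by_cases hA : j ≤ (ones.filter fun e => e.1 ∈ S ∨ e.2 ∈ S).card
  · obtain ⟨h1, h2⟩ := hch _ hA
    refine ⟨_, Finset.mem_union_left _ (Finset.mem_biUnion.2 ⟨S, by simpa using hS,
      Finset.mem_powersetCard.2 ⟨h1.trans ?_, h2⟩⟩), h2, fun e he => ?_⟩
    · exact Finset.filter_subset_filter _ (Finset.subset_univ _)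
    · exact (Finset.mem_filter.1 (Finset.mem_filter.1 (h1 he)).1).2
  · obtain ⟨M, hM, hr⟩ := exists_rank_eq_minRank K R
    have hz : ∀ a b, R a b = true ↔ M a b ≠ 0 := fun a b => by
      rw [← hM]; simp [zeroNonzeroPattern]
    -- Multiplying by `D` on both sides clears the rows and columns in `S` without raising the rank.
    let D : Matrix (Fin n) (Fin n) K := Matrix.diagonal fun v => if v ∈ S then 0 else 1
    let M' := D * M * D
    have hM' : ∀ a b, M' a b = if a ∈ S ∨ b ∈ S then 0 else M a b := by
      intro a b
      simp only [M', D, Matrix.mul_diagonal, Matrix.diagonal_mul]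
      by_cases ha : a ∈ S <;> by_cases hb : b ∈ S <;> simp [ha, hb]
    have hM'mem : M' ∈ sparseLowRank K n d k := by
      refine Finset.mem_filter.2 ⟨Finset.mem_univ _, ?_, fun a => ?_, fun b => ?_⟩
      · exact (Matrix.rank_mul_le_left _ _).trans ((Matrix.rank_mul_le_right _ _).trans
          (hr.trans_le (hk R hR)))
      · refine Finset.mem_filter.2 ⟨Finset.mem_univ _, ?_⟩
        by_cases ha : a ∈ S
        · simp [hM', ha]
        · have h1 : ¬ d ≤ touchDegree R a := fun h => ha (by simpa [S] using h)
          have h2 : (Finset.univ.filter fun l => M' a l ≠ 0) ⊆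
              insert a (Finset.univ.filter fun l => a ≠ l ∧ R a l = true) := by
            intro l hl
            simp only [hM', ha, false_or, Finset.mem_filter, Finset.mem_univ, true_and] at hl
            simp only [Finset.mem_insert, Finset.mem_filter, Finset.mem_univ, true_and, hz]
            by_cases hal : a = l
            · exact Or.inl hal.symm
            · exact Or.inr ⟨hal, fun h => hl (by simp [h])⟩
          have h3 := (Finset.card_le_card h2).trans (Finset.card_insert_le _ _)
          simp only [touchDegree] at h1
          omega
      · refine Finset.mem_filter.2 ⟨Finset.mem_univ _, ?_⟩
        by_cases hb : b ∈ S
        · simp [hM', hb]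
        · have h1 : ¬ d ≤ touchDegree R b := fun h => hb (by simpa [S] using h)
          have h2 : (Finset.univ.filter fun l => M' l b ≠ 0) ⊆
              insert b (Finset.univ.filter fun l => l ≠ b ∧ R l b = true) := by
            intro l hl
            simp only [hM', hb, or_false, Finset.mem_filter, Finset.mem_univ, true_and] at hl
            simp only [Finset.mem_insert, Finset.mem_filter, Finset.mem_univ, true_and, hz]
            by_cases hal : l = b
            · exact Or.inl hal
            · exact Or.inr ⟨hal, fun h => hl (by simp [h])⟩
          have h3 := (Finset.card_le_card h2).trans (Finset.card_insert_le _ _)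
          simp only [touchDegree] at h1
          change (Finset.univ.filter fun l => M' l b ≠ 0).card ≤ d
          omega
    have hsupp : (Finset.univ.filter fun e : Fin n × Fin n => e.1 ≠ e.2 ∧ M' e.1 e.2 ≠ 0) =
        ones.filter fun e => ¬ (e.1 ∈ S ∨ e.2 ∈ S) := by
      ext e
      simp only [ones, Finset.mem_filter, Finset.mem_univ, true_and, hM', hz]
      by_cases he : e.1 ∈ S ∨ e.2 ∈ S <;> simp [he]
    -- Fewer than `j` of the `m` ones touch `S`, and 2j ≤ m + 1, so at least `j` remain.
    have hB : j ≤ (Finset.univ.filter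
        fun e : Fin n × Fin n => e.1 ≠ e.2 ∧ M' e.1 e.2 ≠ 0).card := by
      rw [hsupp]
      have h1 := Finset.card_filter_add_card_filter_not (s := ones)
        (fun e => e.1 ∈ S ∨ e.2 ∈ S)
      have h2 : ones.card = m := hRm
      omega
    obtain ⟨h1, h2⟩ := hch _ hB
    refine ⟨_, Finset.mem_union_right _ (Finset.mem_image_of_mem _ hM'mem), h2, fun e he => ?_⟩
    have h3 := h1 he
    rw [hsupp] at h3
    exact (Finset.mem_filter.1 (Finset.mem_filter.1 h3).1).2

/-! ### Uniform laws and binomial estimates -/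

theorem foolingWith_nonempty {n m : ℕ} (h : m ≤ n.choose 2) : (foolingWith n m).Nonempty := by
  rw [← Finset.card_pos, card_foolingWith]
  exact Nat.mul_pos (Nat.choose_pos h) (by positivity)

theorem two_pow_le_card_foolingWith {n m : ℕ} (h : m ≤ n.choose 2) :
    2 ^ m ≤ (foolingWith n m).card := by
  rw [card_foolingWith]
  exact Nat.le_mul_of_pos_left _ (Nat.choose_pos h)

theorem ceil_density_le {n : ℕ} {p : ℝ} (hp : p ≤ 1) : ⌈p * (n.choose 2 : ℝ)⌉₊ ≤ n.choose 2 := by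
  rw [Nat.ceil_le]
  exact mul_le_of_le_one_left (Nat.cast_nonneg _) hp

theorem lawR_eq (n : ℕ) (p : ℝ) : lawR n p =
    ProbabilityTheory.uniformOn (foolingWith n ⌈p * (n.choose 2 : ℝ)⌉₊ : Set (BinMatrix n)) := by
  rw [lawR]
  congr 1
  ext R
  simp [foolingWith, HasDensity]

open Classical in
/-- An event whose complement has proportion tending to `0` has probability tending to `1`. -/
theorem tendsto_uniformOn_one {𝓕 : ∀ n, Finset (BinMatrix n)} {good : ∀ n, Set (BinMatrix n)}
    {ε : ℕ → ℝ} (hε : Tendsto ε atTop (𝓝 0))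
    (h : ∀ᶠ n in atTop, (𝓕 n).Nonempty ∧
      (((𝓕 n).filter fun R => R ∉ good n).card : ℝ) ≤ ε n * (𝓕 n).card) :
    Tendsto (fun n => ProbabilityTheory.uniformOn (𝓕 n : Set (BinMatrix n)) (good n))
      atTop (𝓝 1) := by
  have hlim : Tendsto (fun n => ENNReal.ofReal (1 - ε n)) atTop (𝓝 1) := by
    have := ENNReal.tendsto_ofReal (tendsto_const_nhds.sub hε : Tendsto (fun n => 1 - ε n) _ _)
    simpa only [sub_zero, ENNReal.ofReal_one] using this
  refine tendsto_of_tendsto_of_tendsto_of_le_of_le' hlim tendsto_const_nhds ?_ ?_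
  · filter_upwards [h] with n ⟨hne, hn⟩
    have hpos : 0 < (𝓕 n).card := hne.card_pos
    have hg : good n = ((good n).toFinset : Set (BinMatrix n)) :=
      (Set.coe_toFinset (good n)).symm
    rw [hg, ProbabilityTheory.uniformOn_apply_finset, ENNReal.le_div_iff_mul_le
      (Or.inl (by exact_mod_cast hpos.ne')) (Or.inl (ENNReal.natCast_ne_top _)),
      ← ENNReal.ofReal_natCast (𝓕 n).card, ← ENNReal.ofReal_natCast (𝓕 n ∩ (good n).toFinset).card,
      ← ENNReal.ofReal_mul' (Nat.cast_nonneg _)]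
    refine ENNReal.ofReal_le_ofReal ?_
    have h1 := Finset.card_filter_add_card_filter_not (s := 𝓕 n) (fun R => R ∈ good n)
    have h2 : (𝓕 n).filter (fun R => R ∈ good n) = 𝓕 n ∩ (good n).toFinset := by
      ext R; simp
    rw [h2] at h1
    have h3 : (((𝓕 n ∩ (good n).toFinset).card : ℕ) : ℝ) +
      (((𝓕 n).filter fun R => R ∉ good n).card : ℝ) = (𝓕 n).card := by exact_mod_cast h1
    linarith
  · filter_upwards [h] with n ⟨hne, _⟩
    have := ProbabilityTheory.isProbabilityMeasure_uniformOn (𝓕 n).finite_toSet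
      (Finset.coe_nonempty.2 hne)
    exact MeasureTheory.prob_le_one

theorem choose_two_cast (n : ℕ) : ((n.choose 2 : ℕ) : ℝ) = n * (n - 1) / 2 :=
  Nat.cast_choose_two ℝ n

/-- Combine C(x,j) ≤ x^j / j! with j^j / j! ≤ e^j, a single term of the exponential series. -/
theorem choose_le_exp_mul_div_pow (x j : ℕ) :
    (x.choose j : ℝ) ≤ (Real.exp 1 * x / j) ^ j := by
  rcases Nat.eq_zero_or_pos j with rfl | hj
  · simp
  have hj' : (0:ℝ) < j := by exact_mod_cast hj
  refine (Nat.choose_le_pow_div j x).trans ?_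
  have h := Real.pow_div_factorial_le_exp (j : ℝ) hj'.le j
  have hf : (0:ℝ) < (j.factorial : ℝ) := by exact_mod_cast j.factorial_pos
  rw [div_le_iff₀ hf] at h
  rw [div_pow, mul_pow, ← Real.exp_nat_mul, mul_one, div_le_div_iff₀ hf (by positivity)]
  calc (x:ℝ) ^ j * j ^ j ≤ (x:ℝ) ^ j * (Real.exp j * j.factorial) :=
        mul_le_mul_of_nonneg_left h (by positivity)
    _ = _ := by ring

/-! ### Linear bounds over arbitrary fields -/

open Classical in
/-- Sparse patterns: an index set of low degree contains a large independent set. -/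
theorem sparse_arbitrary_field (C : ℝ) : ∃ c : ℝ, 0 < c ∧ ∀ (K : Type u) [Field K] (n : ℕ) (p : ℝ)
    (R : BinMatrix n), p ≤ C / n → IsFoolingPattern R → HasDensity R p →
      c * (n : ℝ) ≤ (minRank K R : ℝ) := by
  let D := ⌈|C|⌉₊ + 1
  have hD1 : (1:ℝ) ≤ D := by simp [D]
  refine ⟨1 / (8 * D), by positivity, fun K _ n p R hp hR hd => ?_⟩
  rcases Nat.eq_zero_or_pos n with rfl | hn
  · simp
  have hn' : (1:ℝ) ≤ n := by exact_mod_cast hn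
  have hm : (offDiagOnes R : ℝ) ≤ D * n := by
    have hCD : |C| + 1 ≤ D := by
      simp only [D, Nat.cast_add, Nat.cast_one]
      linarith [Nat.le_ceil |C|]
    have h1 : p * (n.choose 2 : ℝ) ≤ |C| * n := by
      rw [choose_two_cast]
      have h2 : p ≤ |C| / n := hp.trans (by gcongr; exact le_abs_self C)
      have h3 : (0:ℝ) ≤ n * (n - 1) / 2 := by
        have : (0:ℝ) ≤ n - 1 := by linarith
        positivity
      calc p * (n * (n - 1) / 2) ≤ |C| / n * (n * (n - 1) / 2) := by gcongr
        _ = |C| * ((n - 1) / 2) := by field_simp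
        _ ≤ _ := mul_le_mul_of_nonneg_left (by linarith) (abs_nonneg C)
    have h4 : (offDiagOnes R : ℝ) ≤ |C| * n + 1 := by
      rw [show offDiagOnes R = _ from hd]
      have h5 : ((⌈p * (n.choose 2 : ℝ)⌉₊ : ℕ) : ℝ) ≤ (⌈|C| * (n:ℝ)⌉₊ : ℝ) :=
        Nat.cast_le.2 (Nat.ceil_mono h1)
      exact h5.trans (Nat.ceil_lt_add_one (by positivity)).le
    nlinarith
  -- The mean touch degree is at most 2D, so at most half of the indices reach 4D; the other half
  -- gives rank at least n/(8D).
  have h1 := le_minRank_mul_add K hR.1 (4 * D)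
  have h2 := mul_card_high_touchDegree_le R (4 * D)
  set H := (Finset.univ.filter fun v => 4 * D ≤ touchDegree R v).card
  have h1' : (n : ℝ) ≤ minRank K R * (4 * D) + H := by exact_mod_cast h1
  have h2' : (4 * D * H : ℝ) ≤ 2 * offDiagOnes R := by exact_mod_cast h2
  have h3 : (H : ℝ) ≤ n / 2 := by
    have : (D:ℝ) * (4 * H) ≤ D * (2 * n) := by linarith
    have := le_of_mul_le_mul_left this (by linarith)
    linarith
  rw [one_div, inv_mul_eq_div, div_le_iff₀ (by positivity)]
  linarith

open Classical in
/-- Over any field, all but an exponentially small proportion of a large set of patterns has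
linear minimum rank. -/
theorem dense_arbitrary_field {p₀ : ℝ} (h0 : 0 < p₀) (h1 : p₀ ≤ 1) : ∃ c : ℝ, 0 < c ∧
    ∀ (K : Type u) [Field K] (n : ℕ) (p : ℝ) (𝓕 : Finset (BinMatrix n)), 2 ≤ n → p₀ ≤ p →
      2 ^ ⌈p * (n.choose 2 : ℝ)⌉₊ ≤ 𝓕.card →
      ((𝓕.filter fun R => (minRank K R : ℝ) < c * n).card : ℝ) ≤
        Real.exp (-(p₀ / 12 * n)) * 𝓕.card := by
  have hΛ : 0 < Real.log (96 / p₀) := Real.log_pos (by rw [lt_div_iff₀ h0]; linarith)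
  set Λ := Real.log (96 / p₀) with hΛdef
  refine ⟨p₀ / (48 * Λ), by positivity, fun K _ n p 𝓕 hn hp h𝓕 => ?_⟩
  have hn' : (2:ℝ) ≤ n := by exact_mod_cast hn
  have : NeZero n := ⟨by omega⟩
  set c := p₀ / (48 * Λ) with hc
  have hc0 : 0 < c := by positivity
  set k := ⌊c * n⌋₊ with hk
  have hkle : (k : ℝ) ≤ c * n := Nat.floor_le (by positivity)
  -- With δ = p₀/96 the degree factor is e^(p₀n²/24). The choice of `c` bounds the variable factor
  -- e^(2nkΛ) by the same amount.
  have hA := card_patterns_le K (n := n) (k := k) (𝓕.filter fun R => (minRank K R : ℝ) < c * n)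
    (fun R hR => Nat.le_floor (Finset.mem_filter.1 hR).2.le) (δ := p₀ / 96) (by positivity)
    (by linarith)
  have hA' : ((𝓕.filter fun R => (minRank K R : ℝ) < c * n).card : ℝ) ≤
      Real.exp (p₀ / 12 * n ^ 2) := by
    refine hA.trans ?_
    have : (1 / (p₀ / 96)) = Real.exp Λ := by
      rw [hΛdef, Real.exp_log (by positivity), one_div_div]
    rw [this, ← Real.exp_nat_mul, ← Real.exp_add, Real.exp_le_exp]
    push_cast
    have h2 : 2 * ((n:ℝ) * k) * Λ ≤ 2 * (n * (c * n)) * Λ := by gcongr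
    have h3 : 2 * (n * (c * n)) * Λ = p₀ / 24 * n ^ 2 := by
      rw [hc]; field_simp; ring
    linarith
  have hB : Real.exp (p₀ / 6 * n ^ 2) ≤ 𝓕.card := by
    have h2 : ((2 ^ ⌈p * (n.choose 2 : ℝ)⌉₊ : ℕ) : ℝ) ≤ 𝓕.card := by exact_mod_cast h𝓕
    refine le_trans ?_ h2
    push_cast
    have h3 : (2:ℝ) = Real.exp (Real.log 2) := (Real.exp_log (by norm_num)).symm
    conv_rhs => rw [h3, ← Real.exp_nat_mul]
    rw [Real.exp_le_exp]
    -- There are at least n²/4 pairs, and log 2 > 2/3, so the exponent p₀n²/6 is twice that of the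
    -- bound on bad patterns.
    have h4 : p₀ * (n ^ 2 / 4) ≤ (⌈p * (n.choose 2 : ℝ)⌉₊ : ℝ) := by
      refine le_trans ?_ (Nat.le_ceil _)
      rw [choose_two_cast]
      have : (n:ℝ) ^ 2 / 4 ≤ n * (n - 1) / 2 := by nlinarith
      exact mul_le_mul hp this (by positivity) (h0.le.trans hp)
    calc _ ≤ p₀ * (n ^ 2 / 4) * (2 / 3) := le_of_eq (by ring)
      _ ≤ _ := mul_le_mul h4 (by linarith [Real.log_two_gt_d9]) (by norm_num) (by positivity)
  calc _ ≤ Real.exp (p₀ / 12 * n ^ 2) := hA'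
    _ = Real.exp (-(p₀ / 12 * n ^ 2)) * Real.exp (p₀ / 6 * n ^ 2) := by
      rw [← Real.exp_add]; ring_nf
    _ ≤ Real.exp (-(p₀ / 12 * n)) * 𝓕.card := by
      refine mul_le_mul (Real.exp_le_exp.2 ?_) hB (Real.exp_pos _).le (Real.exp_pos _).le
      have : (n:ℝ) ≤ n ^ 2 := by nlinarith
      have := mul_le_mul_of_nonneg_left this (by positivity : 0 ≤ p₀ / 12)
      linarith

/-! ### Bounds over finite fields -/

/-- This is the case of many ones near the exceptional indices: at most n²/50 positions are
available, so the term is at most 2^n (e · (n²/50) · q/j)^j. The base is below 1/4, which absorbs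
2^n. -/
theorem two_pow_mul_choose_mul_pow_le {n j : ℕ} {q : ℝ} (hn : (200:ℝ) ≤ n) (hnj : n ≤ j)
    (hq0 : 0 ≤ q) (hqj : q / j ≤ 1 / (n * (n - 1) / 2)) :
    2 ^ n * ((2 * (n / 100 * n)).choose j : ℝ) * q ^ j ≤ (1 / 2) ^ n := by
  have h1 := choose_le_exp_mul_div_pow (2 * (n / 100 * n)) j
  have h3 : ((2 * (n / 100 * n) : ℕ) : ℝ) ≤ n ^ 2 / 50 := by
    push_cast
    have : ((n / 100 : ℕ) : ℝ) ≤ n / 100 := Nat.cast_div_le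
    nlinarith
  generalize 2 * (n / 100 * n) = x at h1 h3 ⊢
  have hN0 : (0:ℝ) < n * (n - 1) / 2 := by nlinarith
  have h2 : Real.exp 1 * (x : ℝ) / j * q ≤ 1 / 4 := by
    have h4 : Real.exp 1 ≤ 2.72 := by linarith [Real.exp_one_lt_d9]
    calc _ = Real.exp 1 * (x : ℝ) * (q / j) := by ring
      _ ≤ 2.72 * (n ^ 2 / 50) * (1 / (n * (n - 1) / 2)) :=
        mul_le_mul (mul_le_mul h4 h3 (Nat.cast_nonneg _) (by norm_num)) hqj (by positivity)
          (by positivity)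
      _ ≤ 1 / 4 := by
        rw [mul_one_div, div_le_iff₀ hN0]
        nlinarith
  calc _ ≤ 2 ^ n * (Real.exp 1 * (x : ℝ) / j) ^ j * q ^ j := by gcongr
    _ = 2 ^ n * (Real.exp 1 * (x : ℝ) / j * q) ^ j := by rw [mul_assoc, ← mul_pow]
    _ ≤ 2 ^ n * (1 / 4) ^ j := by gcongr
    _ ≤ 2 ^ n * (1 / 4) ^ n :=
      mul_le_mul_of_nonneg_left (pow_le_pow_of_le_one (by norm_num) (by norm_num) hnj)
        (by positivity)
    _ = _ := by rw [← mul_pow]; norm_num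

/-- This is the sparse low-rank case: two positions and two vectors per index below k, each with at
most e^w choices, against containment probability e^(-jL). -/
theorem mul_pow_mul_pow_le_half_pow {n j k : ℕ} {V w q L : ℝ} (hn : (n:ℝ) ≤ Real.exp w)
    (hV0 : 0 ≤ V) (hV : V ≤ Real.exp w) (hq0 : 0 ≤ q) (hq : q ≤ Real.exp (-L))
    (h : n * Real.log 2 ≤ j * L - 4 * k * w) :
    ((n:ℝ) * n * (V * V)) ^ k * q ^ j ≤ (1 / 2) ^ n := by
  have hhalf : (1 / 2 : ℝ) ^ n = Real.exp (-(n * Real.log 2)) := by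
    rw [Real.exp_neg, Real.exp_nat_mul, Real.exp_log (by norm_num)]
    simp
  calc ((n:ℝ) * n * (V * V)) ^ k * q ^ j
      ≤ (Real.exp w * Real.exp w * (Real.exp w * Real.exp w)) ^ k * Real.exp (-L) ^ j := by
        gcongr
    _ = Real.exp (4 * k * w - j * L) := by
      rw [← Real.exp_add, ← Real.exp_add, ← Real.exp_nat_mul, ← Real.exp_nat_mul,
        ← Real.exp_add]
      ring_nf
    _ ≤ _ := by
      rw [hhalf, Real.exp_le_exp]
      linarith

set_option maxHeartbeats 1000000 in
open Classical in
/-- Over a finite field, the proportion of patterns of density `p` of small minimum rank. -/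
theorem sparse_finite_field (K : Type u) [Field K] [Finite K] {n : ℕ} {p : ℝ} (hn : 0 < n)
    (hp : 100 / (n : ℝ) ≤ p) (hp2 : p ≤ 1 / 2) :
    (((foolingWith n ⌈p * (n.choose 2 : ℝ)⌉₊).filter fun R => (minRank K R : ℝ) <
      1 / 10000 * (Real.log (1 / p) / (Real.log (1 / p) + Real.log (Nat.card K : ℝ)) * n)).card
      : ℝ) ≤ 2 * (1 / 2) ^ n * (foolingWith n ⌈p * (n.choose 2 : ℝ)⌉₊).card := by
  have := Fintype.ofFinite K
  have : NeZero n := ⟨hn.ne'⟩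
  have hn0 : (0:ℝ) < n := by exact_mod_cast hn
  have hpn : 100 ≤ p * n := by rwa [div_le_iff₀ hn0] at hp
  have hp0 : 0 < p := lt_of_lt_of_le (by positivity) hp
  have hn200 : (200:ℝ) ≤ n := by nlinarith
  set N : ℝ := (n.choose 2 : ℝ) with hN
  have hNeq : N = n * (n - 1) / 2 := choose_two_cast n
  set m := ⌈p * N⌉₊ with hm
  have hmlow : p * N ≤ m := Nat.le_ceil _
  have hN0 : 0 < N := by
    rw [hNeq]
    exact div_pos (mul_pos hn0 (by linarith)) two_pos
  -- Rounding up costs at most a factor 2, which the 2N in `q` cancels, giving q ≤ p.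
  have hmup : (m:ℝ) ≤ 2 * (p * N) := by
    have h1 := (Nat.ceil_lt_add_one (mul_pos hp0 hN0).le).le
    have h2 : 1 ≤ p * N := by
      rw [hNeq]
      linarith [mul_le_mul hpn (by linarith : (199:ℝ) ≤ n - 1) (by norm_num) (by linarith)]
    linarith
  have hpN : p * n ^ 2 * 49 / 100 ≤ p * N := by
    rw [hNeq]
    linarith [mul_le_mul_of_nonneg_left hn200 (mul_pos hp0 hn0).le]
  have hm49 : 49 * (n:ℝ) ≤ m := by linarith [mul_le_mul_of_nonneg_right hpn hn0.le]
  set L := Real.log (1 / p) with hL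
  set ℓ := Real.log (Nat.card K : ℝ) with hℓ
  have hL2 : Real.log 2 ≤ L := Real.log_le_log (by norm_num) (by
    rw [le_div_iff₀ hp0]; linarith)
  have hlog2 := Real.log_two_gt_d9
  have hF2 : (2:ℝ) ≤ Nat.card K := by
    exact_mod_cast (Finite.one_lt_card : 1 < Nat.card K)
  have hℓ0 : 0 < ℓ := Real.log_pos (by linarith)
  have hexpL : Real.exp L = 1 / p := Real.exp_log (by positivity)
  have hexpℓ : Real.exp ℓ = Nat.card K := Real.exp_log (by linarith)
  set X := 1 / 10000 * (L / (L + ℓ) * n) with hX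
  have hX0 : 0 ≤ X := by have : 0 < L := by linarith
                         positivity
  set k := ⌊X⌋₊ with hk
  have hkle : (k:ℝ) ≤ X := Nat.floor_le hX0
  -- With this threshold at most 2m/d ≤ n/100 indices are exceptional.
  set d := ⌈200 * (m:ℝ) / n⌉₊ with hd
  have hdlow : 200 * (m:ℝ) / n ≤ d := Nat.le_ceil _
  have hdlow' : 200 * (m:ℝ) ≤ d * n := by rwa [div_le_iff₀ hn0] at hdlow
  have hdup : (d:ℝ) * n ≤ 201 * m := by
    have h1 := (Nat.ceil_lt_add_one (by positivity : 0 ≤ 200 * (m:ℝ) / n)).le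
    have h2 : (d:ℝ) * n ≤ (200 * (m:ℝ) / n + 1) * n := by gcongr
    have h3 : (200 * (m:ℝ) / n + 1) * n = 200 * m + n := by field_simp
    linarith
  have hnpd : n * p ≤ d := by
    have : (n * p) * n ≤ d * n := by
      have : 0 ≤ p * n ^ 2 := by positivity
      linarith
    exact le_of_mul_le_mul_right this hn0
  have hd1 : (1:ℝ) ≤ d := by linarith
  have hs : 2 * m < d * (n / 100 + 1) := by
    have h1 : (n:ℝ) < 100 * ((n / 100 : ℕ) + 1 : ℝ) := by
      have : n < 100 * (n / 100 + 1) := by omega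
      exact_mod_cast this
    have h2 : (2 * m : ℝ) < d * ((n / 100 : ℕ) + 1) := by
      linarith [mul_lt_mul_of_pos_left h1 (by linarith : (0:ℝ) < d)]
    exact_mod_cast h2
  set bad := (foolingWith n m).filter fun R => (minRank K R : ℝ) < X with hbad
  have main := card_minRank_le_mul_pow_le K (m := m) (d := d) (k := k) (s := n / 100) bad
    (Finset.filter_subset _ _) (fun R hR => Nat.le_floor (Finset.mem_filter.1 hR).2.le) hs
  set j := (m + 1) / 2 with hj
  have hj2 : (m:ℝ) ≤ 2 * j := by
    have : m ≤ 2 * j := by omega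
    exact_mod_cast this
  have hjpos : (0:ℝ) < j := by linarith
  have hnj : 24 * (n:ℝ) ≤ j := by linarith
  set V := (sparseVectors K n d).card with hV
  have main' : (bad.card : ℝ) * (2 * N) ^ j ≤
      (2 ^ n * ((2 * (n / 100 * n)).choose j : ℝ) + (n * n * (V * V)) ^ k) *
        (m ^ j * (foolingWith n m).card) := by
    rw [hN]
    exact_mod_cast main
  set q := (m:ℝ) / (2 * N) with hq
  have hq0 : 0 ≤ q := by positivity
  have hqp : q ≤ p := by
    rw [hq, div_le_iff₀ (by positivity)]; linarith
  have hA : 2 ^ n * ((2 * (n / 100 * n)).choose j : ℝ) * q ^ j ≤ (1 / 2) ^ n := by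
    have h5 : q / j ≤ 1 / N := by
      rw [hq, div_div, div_le_div_iff₀ (by positivity) hN0]
      linarith [mul_le_mul_of_nonneg_right hj2 hN0.le]
    have h6 : n ≤ j := by
      have : (n:ℝ) ≤ j := by linarith
      exact_mod_cast this
    rw [hNeq] at h5
    exact two_pow_mul_choose_mul_pow_le hn200 h6 hq0 h5
  have hB : ((n:ℝ) * n * (V * V)) ^ k * q ^ j ≤ (1 / 2) ^ n := by
    -- The sparse vector count is at most e^(d(L + ℓ) + np), and np ≤ d.
    set w := (d:ℝ) * (1 + L + ℓ) with hw
    have hVw : (V:ℝ) ≤ Real.exp w := by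
      refine (card_sparseVectors_le K n d hp0 (by linarith)).trans ?_
      rw [← Nat.card_eq_fintype_card, ← hexpℓ, div_eq_mul_one_div, ← hexpL, ← Real.exp_add,
        ← Real.exp_nat_mul, ← Real.exp_add, Real.exp_le_exp, hw]
      linarith
    have hnw : (n:ℝ) ≤ Real.exp w := by
      have h1 : (n:ℝ) ≤ Real.exp (d + L) := by
        rw [Real.exp_add, hexpL, mul_one_div, le_div_iff₀ hp0]
        linarith [Real.add_one_le_exp (d:ℝ)]
      refine h1.trans (Real.exp_le_exp.2 ?_)
      rw [hw]
      have h2 : 1 * L ≤ d * L := mul_le_mul_of_nonneg_right hd1 (by linarith)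
      have h3 : 0 ≤ d * ℓ := by positivity
      linarith
    have hkX : (k:ℝ) * (L + ℓ) ≤ 1 / 10000 * n * L := by
      have h1 : (k:ℝ) * (L + ℓ) ≤ X * (L + ℓ) := by
        have : 0 ≤ L + ℓ := by linarith
        gcongr
      refine h1.trans_eq ?_
      have : L + ℓ ≠ 0 := by linarith
      rw [hX]; field_simp
    have hL0 : 0 < L := by linarith
    have hpe : p = Real.exp (-L) := by rw [Real.exp_neg, hexpL]; simp
    -- Here 4kw ≤ 12dk(L + ℓ) ≤ (12/10000)dnL, and dn ≤ 402j, so 4kw is less than half of jL. The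
    -- rest suffices since jL ≥ 24 n log 2.
    have hexpo : n * Real.log 2 ≤ j * L - 4 * k * w := by
      have h1 : 1 + L + ℓ ≤ 3 * (L + ℓ) := by linarith
      have h2 : 4 * k * w ≤ 12 * d * (k * (L + ℓ)) := by
        rw [hw]
        have : (4 * k * d : ℝ) * (1 + L + ℓ) ≤ (4 * k * d : ℝ) * (3 * (L + ℓ)) :=
          mul_le_mul_of_nonneg_left h1 (by positivity)
        linarith
      have h3 : 12 * d * (k * (L + ℓ)) ≤ 12 * d * (1 / 10000 * n * L) :=
        mul_le_mul_of_nonneg_left hkX (by positivity)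
      have h4 : (d * n : ℝ) * L ≤ (402 * j) * L := by
        refine mul_le_mul_of_nonneg_right ?_ hL0.le
        linarith
      have h5 : 24 * (n:ℝ) * Real.log 2 ≤ j * L :=
        mul_le_mul hnj hL2 (by linarith) hjpos.le
      have h6 : 0 ≤ (n:ℝ) * Real.log 2 := by positivity
      linarith
    exact mul_pow_mul_pow_le_half_pow hnw (Nat.cast_nonneg _) hVw hq0 (hqp.trans_eq hpe) hexpo
  have hfin : (bad.card : ℝ) ≤
      (2 ^ n * ((2 * (n / 100 * n)).choose j : ℝ) + (n * n * (V * V)) ^ k) * q ^ j *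
        (foolingWith n m).card := by
    rw [hq, div_pow, mul_div_assoc', div_mul_eq_mul_div, le_div_iff₀ (by positivity)]
    refine main'.trans_eq (by ring)
  refine hfin.trans (mul_le_mul_of_nonneg_right ?_ (Nat.cast_nonneg _))
  rw [add_mul]
  exact (add_le_add hA hB).trans_eq (two_mul _).symm

theorem tendsto_exp_neg_mul_nat {a : ℝ} (ha : 0 < a) :
    Tendsto (fun n : ℕ => Real.exp (-(a * n))) atTop (𝓝 0) :=
  Real.tendsto_exp_neg_atTop_nhds_zero.comp
    (Tendsto.const_mul_atTop ha tendsto_natCast_atTop_atTop)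

open Classical in
/-- Over a finite field both lower bounds hold for all but a vanishing proportion of the patterns
of density `p`. -/
theorem finite_field_bound : ∃ c : ℝ, 0 < c ∧ ∃ a : ℝ, 0 < a ∧ ∀ (K : Type u) [Field K] [Finite K]
    (n : ℕ) (p : ℝ), 2 ≤ n → 100 / (n : ℝ) ≤ p → p ≤ 1 →
    (((foolingWith n ⌈p * (n.choose 2 : ℝ)⌉₊).filter fun R =>
      ¬ (c * (Real.log (1 / p) /
                  (Real.log (1 / p) + Real.log (Nat.card K : ℝ)) * (n : ℝ))
                ≤ (minRank K R : ℝ) ∧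
              c * ((n : ℝ) / Real.log (Nat.card K : ℝ)) ≤ (minRank K R : ℝ))).card : ℝ) ≤
      (2 * (1 / 2) ^ n + Real.exp (-(a * n))) * (foolingWith n ⌈p * (n.choose 2 : ℝ)⌉₊).card := by
  obtain ⟨c₁, hc₁, hdense⟩ := dense_arbitrary_field.{u} (p₀ := 1 / 2) (by norm_num) (by norm_num)
  have hlog2 := Real.log_two_gt_d9
  refine ⟨min (1 / 10000) c₁ / 4, by positivity, 1 / 2 / 12, by norm_num,
    fun K _ _ n p hn hp hp1 => ?_⟩
  set c := min (1 / 10000) c₁ / 4 with hc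
  have hc0 : 0 < c := by positivity
  have hcs : 4 * c ≤ 1 / 10000 := by rw [hc]; linarith [min_le_left (1 / 10000) c₁]
  have hcd : 4 * c ≤ c₁ := by rw [hc]; linarith [min_le_right (1 / 10000) c₁]
  have hn0 : (0:ℝ) < n := by exact_mod_cast (by omega : 0 < n)
  have hp0 : 0 < p := lt_of_lt_of_le (by positivity) hp
  set m := ⌈p * (n.choose 2 : ℝ)⌉₊ with hm
  have hF2 : (2:ℝ) ≤ Nat.card K := by
    exact_mod_cast (Finite.one_lt_card : 1 < Nat.card K)
  have hℓ : Real.log 2 ≤ Real.log (Nat.card K : ℝ) := Real.log_le_log (by norm_num) hF2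
  set ℓ := Real.log (Nat.card K : ℝ)
  have hL0 : 0 ≤ Real.log (1 / p) := Real.log_nonneg (by rwa [le_div_iff₀ hp0, one_mul])
  have hexp := Real.exp_pos (-(1 / 2 / 12 * n : ℝ))
  have hpow : (0:ℝ) < (1 / 2) ^ n := by positivity
  -- For p ≤ 1/2, both L and ℓ are at least log 2 > 1/2, so L/(L + ℓ) ≥ 1/(4ℓ) and the first bound
  -- implies the second. For p > 1/2 both follow from the linear bound, as L/(L + ℓ) ≤ 1 and 1/ℓ ≤
  -- 4.
  rcases le_or_gt p (1 / 2) with hp2 | hp2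
  · have hL : Real.log 2 ≤ Real.log (1 / p) := Real.log_le_log (by norm_num) (by
      rw [le_div_iff₀ hp0]; linarith)
    have hb := sparse_finite_field K (by omega) hp hp2
    rw [← hm] at hb
    set L := Real.log (1 / p)
    refine le_trans ?_ (hb.trans (mul_le_mul_of_nonneg_right (by linarith) (Nat.cast_nonneg _)))
    rw [Nat.cast_le]
    refine Finset.card_le_card (Finset.monotone_filter_right _ fun R _ hR => ?_)
    by_contra! hcon
    refine hR ⟨?_, ?_⟩
    · refine le_trans (mul_le_mul_of_nonneg_right (by linarith) ?_) hcon
      exact mul_nonneg (div_nonneg hL0 (by linarith)) hn0.le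
    · refine le_trans ?_ hcon
      have h1 : c * (1 / ℓ) ≤ 1 / 10000 * (L / (L + ℓ)) := by
        have hℓ0 : 0 < ℓ := by linarith
        have hLℓ : 0 < L + ℓ := by linarith
        have h2 : 1 / (4 * ℓ) ≤ L / (L + ℓ) := by
          rw [div_le_div_iff₀ (by positivity) hLℓ]
          have h3 : 1 ≤ 2 * L := by linarith
          have h4 := mul_le_mul_of_nonneg_right h3 hℓ0.le
          have h5 : 1 ≤ 2 * ℓ := by linarith
          have h6 := mul_le_mul_of_nonneg_left h5 hL0
          linarith
        calc c * (1 / ℓ) = 4 * c * (1 / (4 * ℓ)) := by field_simp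
          _ ≤ _ := mul_le_mul hcs h2 (by positivity) (by norm_num)
      calc c * (n / ℓ) = c * (1 / ℓ) * n := by ring
        _ ≤ 1 / 10000 * (L / (L + ℓ)) * n := mul_le_mul_of_nonneg_right h1 hn0.le
        _ = _ := by ring
  · have hb := hdense K n p (foolingWith n m) hn hp2.le
      (two_pow_le_card_foolingWith (ceil_density_le hp1))
    refine le_trans ?_ (hb.trans (mul_le_mul_of_nonneg_right (by linarith) (Nat.cast_nonneg _)))
    rw [Nat.cast_le]
    refine Finset.card_le_card (Finset.monotone_filter_right _ fun R _ hR => ?_)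
    by_contra! hcon
    refine hR ⟨?_, ?_⟩
    · refine le_trans ?_ hcon
      have h1 : Real.log (1 / p) / (Real.log (1 / p) + ℓ) ≤ 1 :=
        div_le_one_of_le₀ (by linarith) (by linarith)
      have h2 := mul_le_mul_of_nonneg_right h1 hn0.le
      exact mul_le_mul (by linarith) (by linarith) (mul_nonneg (div_nonneg hL0 (by linarith))
        hn0.le) hc₁.le
    · refine le_trans ?_ hcon
      have h1 : n / ℓ ≤ 4 * n := by
        rw [div_le_iff₀ (by linarith)]
        have h5 : 1 ≤ 4 * ℓ := by linarith
        linarith [mul_le_mul_of_nonneg_left h5 hn0.le]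
      calc c * (n / ℓ) ≤ c * (4 * n) := mul_le_mul_of_nonneg_left h1 hc0.le
        _ = 4 * c * n := by ring
        _ ≤ _ := mul_le_mul_of_nonneg_right hcd hn0.le

/-! ### Passage to the limit -/

theorem theorem1 :
    -- (a) density `p = O(1/n)`, arbitrary field
    (∀ C : ℝ, ∃ c : ℝ, 0 < c ∧ ∀ (K : Type u) [Field K] (p : ℕ → ℝ),
      (∀ᶠ n : ℕ in atTop, 0 < p n ∧ p n ≤ 1 ∧ p n ≤ C / (n : ℝ)) →
      Tendsto (fun n : ℕ => lawR n (p n) {R | c * (n : ℝ) ≤ (minRank K R : ℝ)})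
        atTop (𝓝 1)) ∧
    -- (b) finite fields, which may vary with `n`
    (∃ c : ℝ, 0 < c ∧ ∀ (K : ℕ → Type u) [∀ n, Field (K n)] [∀ n, Finite (K n)] (p : ℕ → ℝ),
      (∀ᶠ n : ℕ in atTop,
        100 * max 1 (Real.log (Real.log (Nat.card (K n) : ℝ))) / (n : ℝ) ≤ p n ∧ p n ≤ 1) →
      Tendsto (fun n : ℕ => lawR n (p n)
          {R | c * (Real.log (1 / p n) /
                  (Real.log (1 / p n) + Real.log (Nat.card (K n) : ℝ)) * (n : ℝ))
                ≤ (minRank (K n) R : ℝ) ∧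
              c * ((n : ℝ) / Real.log (Nat.card (K n) : ℝ)) ≤ (minRank (K n) R : ℝ)})
        atTop (𝓝 1)) ∧
    -- (c) constant density, arbitrary field
    (∀ p : ℝ, 0 < p → p ≤ 1 → ∃ c : ℝ, 0 < c ∧ ∀ (K : Type u) [Field K],
      Tendsto (fun n : ℕ => lawR n p {R | c * (n : ℝ) ≤ (minRank K R : ℝ)})
        atTop (𝓝 1)) ∧
    -- (c) uniform pattern, arbitrary field
    (∃ c : ℝ, 0 < c ∧ ∀ (K : Type u) [Field K],
      Tendsto (fun n : ℕ => lawQ n {R | c * (n : ℝ) ≤ (minRank K R : ℝ)})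
        atTop (𝓝 1)) := by

  classical
  refine ⟨fun C => ?_, ?_, fun p hp0 hp1 => ?_, ?_⟩
  · obtain ⟨c, hc, h⟩ := sparse_arbitrary_field.{u} C
    refine ⟨c, hc, fun K _ p hp => ?_⟩
    simp only [lawR_eq]
    -- No pattern is exceptional in the sparse regime.
    refine tendsto_uniformOn_one (ε := fun _ => 0) tendsto_const_nhds ?_
    filter_upwards [hp] with n ⟨_, hp1, hpC⟩
    refine ⟨foolingWith_nonempty (ceil_density_le hp1), ?_⟩
    simp only [not_le]
    rw [zero_mul, Finset.filter_false_of_mem]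
    · simp
    · intro R hR
      obtain ⟨-, hF, hd⟩ := Finset.mem_filter.1 hR
      exact not_lt.2 (h K n (p n) R hpC hF hd)
  · obtain ⟨c, hc, a, ha, h⟩ := finite_field_bound.{u}
    refine ⟨c, hc, fun K _ _ p hp => ?_⟩
    simp only [lawR_eq]
    have hlim : Tendsto (fun n : ℕ => 2 * (1 / 2 : ℝ) ^ n + Real.exp (-(a * n))) atTop (𝓝 0) := by
      have h1 := (tendsto_pow_atTop_nhds_zero_of_lt_one (r := (1 / 2 : ℝ)) (by norm_num)
        (by norm_num)).const_mul 2
      simpa only [mul_zero, add_zero] using h1.add (tendsto_exp_neg_mul_nat ha)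
    refine tendsto_uniformOn_one hlim ?_
    filter_upwards [hp, eventually_ge_atTop 2] with n ⟨hpn, hp1⟩ hn
    have hpn' : 100 / (n : ℝ) ≤ p n := by
      refine le_trans ?_ hpn
      gcongr
      linarith [le_max_left 1 (Real.log (Real.log (Nat.card (K n) : ℝ)))]
    refine ⟨foolingWith_nonempty (ceil_density_le hp1), ?_⟩
    convert h (K n) n (p n) hn hpn' hp1
  · obtain ⟨c, hc, h⟩ := dense_arbitrary_field.{u} hp0 hp1
    refine ⟨c, hc, fun K _ => ?_⟩
    simp only [lawR_eq]
    refine tendsto_uniformOn_one (tendsto_exp_neg_mul_nat (a := p / 12) (by positivity)) ?_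
    filter_upwards [eventually_ge_atTop 2] with n hn
    refine ⟨foolingWith_nonempty (ceil_density_le hp1), ?_⟩
    simp only [not_le]
    exact h K n p _ hn le_rfl (two_pow_le_card_foolingWith (ceil_density_le hp1))
  · obtain ⟨c, hc, h⟩ := dense_arbitrary_field.{u} (p₀ := 1) one_pos le_rfl
    refine ⟨c, hc, fun K _ => ?_⟩
    have hQ : ∀ n, lawQ n = ProbabilityTheory.uniformOn
        ((Finset.univ.filter fun R : BinMatrix n => IsFoolingPattern R : Finset (BinMatrix n)) :
          Set (BinMatrix n)) := fun n => by
      rw [lawQ]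
      congr 1
      ext R
      simp
    simp only [hQ]
    refine tendsto_uniformOn_one (tendsto_exp_neg_mul_nat (a := 1 / 12) (by norm_num)) ?_
    filter_upwards [eventually_ge_atTop 2] with n hn
    -- The patterns of density 1, in which every pair is oriented, already make the family of all
    -- patterns large enough for the counting bound.
    have hsub : foolingWith n ⌈(1:ℝ) * (n.choose 2 : ℝ)⌉₊ ⊆
        Finset.univ.filter fun R : BinMatrix n => IsFoolingPattern R := fun R hR =>
      Finset.mem_filter.2 ⟨Finset.mem_univ _, (Finset.mem_filter.1 hR).2.1⟩
    have hle : ⌈(1:ℝ) * (n.choose 2 : ℝ)⌉₊ ≤ n.choose 2 := ceil_density_le le_rfl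
    refine ⟨(foolingWith_nonempty hle).mono hsub, ?_⟩
    simp only [not_le]
    exact h K n 1 _ hn le_rfl
      ((two_pow_le_card_foolingWith hle).trans (Finset.card_le_card hsub))
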